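/- Let $\alpha,\beta_1,\beta_2,\gamma\in(0,1]$ satisfy $$\beta_1+\beta_2>1,\qquad \alpha+\beta_1+\beta_2>2,\qquad (1+\gamma)\beta_i+\beta_1+\beta_2>2\quad(i=1,2).$$ Below, $C^{\beta}$ denotes the space of functions $h\colon\mathbb R^2\to\mathbb R$ whose Hölder norm $\|h\|_\infty+[h]_\beta$ is finite over every ball, and $C^{1,\gamma}$ the space of differentiable $h\colon\mathbb R^2\to\mathbb R$ for which $\|h\|_\infty+\|Dh\|_\infty+[Dh]_\gamma$ is finite over every ball; both carry the topology defined by these norms over balls. Let $F\colon\mathbb R^2\times\mathbb R^2\to\mathbb R$ be such that (i) $u\mapsto F(u,\cdot)$ is a continuous map from $\mathbb R^2$ to $C^{1,\gamma}$; (ii) $u\mapsto F(\cdot,u)$ is a continuous map from $\mathbb R^2$ to $C^{\alpha}$. For $g=(g^1,g^2)\colon\mathbb R^2\to\mathbb R^2$ put $f(x):=F(x,g(x))$ and, for an oriented triangle $[pqr]$ (an ordered triple of points of $\mathbb R^2$, possibly degenerate), $$\mathsf{strat}_{pqr}:=\frac12\cdot\frac{f(p)+f(q)+f(r)}{3}\,\det\begin{pmatrix}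 g^1(q)-g^1(p)& g^1(r)-g^1(p)\\ g^2(q)-g^2(p)& g^2(r)-g^2(p)\end{pmatrix}.$$ Let $\operatorname{dya}[p_0p_1p_2]:=[q_0q_1q_2]+[q_1q_0p_2]+[q_2p_1q_0]+[p_0q_2q_1]$, where $q_i$ is the midpoint of $p_j$ and $p_\ell$, $\{i,j,\ell\}=\{0,1,2\}$. Extend $\operatorname{dya}$ and $\mathsf{strat}$ by linearity to formal real linear combinations of triangles, and let $\mathsf{strat}^n_{pqr}:=\langle\operatorname{dya}^n[pqr],\mathsf{strat}\rangle$. If $g^1\in C^{\beta_1}$ and $g^2\in C^{\beta_2}$, then for all $p,q,r\in\mathbb R^2$ the limit $$V_{pqr}(g)=\int_{[pqr]}F(x,g(x))\,dg^1(x)\wedge dg^2(x):=\lim_{n\to\infty}\mathsf{strat}^n_{pqr}$$ exists; for fixed $g$ it is a continuous function of $(p,q,r)$, it is alternating (permuting the vertices multiplies it by the sign of the permutation), and it is nonatomic ($V_{pqr}(g)=0$ whenever the triangle with vertices $p,q,r$ has zero area). Moreover, for fixed $[pqr]$, $V_{pqr}$ is continuous in $g$ with respect to pointwise convergence with bounded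 Hölder constants: if $g_k\to g$ pointwise on $\mathbb R^2$ and, over every ball, the Hölder seminorms $[g_k^1]_{\beta_1}$ and $[g_k^2]_{\beta_2}$ are bounded uniformly in $k$, then $V_{pqr}(g_k)\to V_{pqr}(g)$. -/

import Mathlib

open Filter Topology Metric MeasureTheory
open scoped NNReal ENNReal

namespace RoughForm

noncomputable section

/-- The Euclidean plane. -/
abbrev Plane : Type := EuclideanSpace ℝ (Fin 2)

/-! ### Simplices, chains, germs -/

/-- Oriented 2-simplices `[p₀ p₁ p₂]` in the plane: ordered triples of points, degenerate ones
included. -/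
abbrev Simp2 : Type := Fin 3 → Plane

/-- Real polyhedral 2-chains: the real vector space freely generated by the 2-simplices. -/
abbrev Chain2 : Type := Simp2 →₀ ℝ

/-- 2-germs: real functions of 2-simplices. -/
abbrev Germ2 : Type := Simp2 → ℝ

/-- The pairing `⟨C, ω⟩`, i.e. the extension of the germ `ω` to chains by linearity. -/
def pairing (C : Chain2) (ω : Germ2) : ℝ := C.sum fun S c => c * ω S

/-- The dyadic decomposition
`[q₀ q₁ q₂] + [q₁ q₀ p₂] + [q₂ p₁ q₀] + [p₀ q₂ q₁]` of one simplex `[p₀ p₁ p₂]`,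
where `qᵢ` is the midpoint of the side opposite to `pᵢ`. -/
def dyaSimplex (S : Simp2) : Chain2 :=
  let q0 := midpoint ℝ (S 1) (S 2)
  let q1 := midpoint ℝ (S 0) (S 2)
  let q2 := midpoint ℝ (S 0) (S 1)
  Finsupp.single ![q0, q1, q2] 1 + Finsupp.single ![q1, q0, S 2] 1
    + Finsupp.single ![q2, S 1, q0] 1 + Finsupp.single ![S 0, q2, q1] 1

/-- The dyadic decomposition, extended to chains by linearity. -/
def dya : Chain2 →ₗ[ℝ] Chain2 := Finsupp.linearCombination ℝ dyaSimplex

/-- A germ is alternating if permuting the vertices multiplies it by the sign of the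
permutation. -/
def Alternating (ω : Germ2) : Prop :=
  ∀ (σ : Equiv.Perm (Fin 3)) (S : Simp2),
    ω (fun i => S (σ i)) = ((Equiv.Perm.sign σ : ℤ) : ℝ) * ω S

/-- A germ is nonatomic if it vanishes on the simplices of zero area. -/
def Nonatomic (ω : Germ2) : Prop :=
  ∀ S : Simp2, volume (convexHull ℝ (Set.range S)) = 0 → ω S = 0

/-! ### Stratonovich germs, sums and integral -/

/-- The Stratonovich germ
`½ · (f_p + f_q + f_r)/3 · det (δg¹_{pq}, δg¹_{pr}; δg²_{pq}, δg²_{pr})`. -/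
def strat (f g1 g2 : Plane → ℝ) : Germ2 := fun S =>
  1 / 2 * ((f (S 0) + f (S 1) + f (S 2)) / 3) *
    Matrix.det !![g1 (S 1) - g1 (S 0), g1 (S 2) - g1 (S 0);
                  g2 (S 1) - g2 (S 0), g2 (S 2) - g2 (S 0)]

/-- The `n`-th Stratonovich sum `⟨dyaⁿ [pqr], strat⟩`. -/
def stratSum (f g1 g2 : Plane → ℝ) (n : ℕ) : Germ2 := fun S =>
  pairing (dya^[n] (Finsupp.single S 1)) (strat f g1 g2)

/-- The germ `∫_{[pqr]} F(x, g(x)) dg¹ ∧ dg²`: the limit of the Stratonovich sums for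
`f(x) = F(x, g(x))` (meaningful when this limit exists). -/
def stratIntegral (F : Plane → Plane → ℝ) (g : Plane → Plane) : Germ2 := fun S =>
  limUnder atTop fun n : ℕ =>
    stratSum (fun x => F x (g x)) (fun x => g x 0) (fun x => g x 1) n S

/-! ### Hölder spaces, on bounded sets -/

/-- The Hölder norm `‖f‖_∞ + [δf]_α` over the set `s`. -/
def holderNormOn {Y : Type*} [NormedAddCommGroup Y] (α : ℝ≥0) (s : Set Plane) (f : Plane → Y) :
    ℝ≥0∞ :=
  (⨆ x ∈ s, ‖f x‖ₑ) + eHolderNorm α (s.domRestrict f)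

/-- The `C^{1,γ}` norm `‖f‖_∞ + ‖Df‖_∞ + [Df]_γ` over the set `s`. -/
def c1HolderNormOn (γ : ℝ≥0) (s : Set Plane) (f : Plane → ℝ) : ℝ≥0∞ :=
  (⨆ x ∈ s, ‖f x‖ₑ) + holderNormOn γ s (fderiv ℝ f)

/-- `f` is of class `C^α` on every bounded set. -/
def IsHolder (α : ℝ≥0) (f : Plane → ℝ) : Prop :=
  ∀ R : ℝ, holderNormOn α (closedBall 0 R) f < ⊤

/-- `f` is of class `C^{1,γ}` on every bounded set. -/
def IsC1Holder (γ : ℝ≥0) (f : Plane → ℝ) : Prop :=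
  Differentiable ℝ f ∧ ∀ R : ℝ, c1HolderNormOn γ (closedBall 0 R) f < ⊤

/-- `u ↦ Φ u` is a continuous map from the plane to `C^α`, with the topology of the Hölder norms
over balls. -/
def ContinuousToHolder (α : ℝ≥0) (Φ : Plane → Plane → ℝ) : Prop :=
  (∀ u, IsHolder α (Φ u)) ∧
    ∀ (R : ℝ) (u₀ : Plane),
      Tendsto (fun u => holderNormOn α (closedBall 0 R) (Φ u - Φ u₀)) (𝓝 u₀) (𝓝 0)

/-- `u ↦ Φ u` is a continuous map from the plane to `C^{1,γ}`, with the topology of the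
`C^{1,γ}` norms over balls. -/
def ContinuousToC1Holder (γ : ℝ≥0) (Φ : Plane → Plane → ℝ) : Prop :=
  (∀ u, IsC1Holder γ (Φ u)) ∧
    ∀ (R : ℝ) (u₀ : Plane),
      Tendsto (fun u => c1HolderNormOn γ (closedBall 0 R) (Φ u - Φ u₀)) (𝓝 u₀) (𝓝 0)

end

end RoughForm

namespace RoughForm

/-! ### Dyadic subdivision acting on germs -/

/-! The dyadic sums are iterates of `dyaGerm` applied to the Stratonovich germ, so convergence
depends on how far that germ is from being additive under one subdivision. When the integrand is
affine in `(g1, g2)`, the germ is the exact integral of an affine density over the image triangle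
with vertices g(p), g(q), g(r). The four small image triangles then differ from the large one only
by three triangles, each with the images of p, (p+q)/2, q as vertices for a side pq
(`stratDefect_affine`). For a general integrand, subtracting an affine approximation of error
|p-q|^σ leaves a defect of order σ + β₁ + β₂ (`Controlled.germBound_stratDefect`), while the side
triangles form a coboundary of order β₁ + β₂.

Under iteration the interior edges of the coboundary cancel, so only 2^n pieces per side remain,
each of size 2^(-n(β₁+β₂)); the defect contributes 4^n pieces of size 2^(-n(σ+β₁+β₂)). Both totals
decay geometrically because β₁ + β₂ > 1 and σ + β₁ + β₂ > 2. For F(x, g(x)), expanding F(p, ·) to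
first order at g(p) gives σ = min(α, (1+γ) min(β₁, β₂)) (`exists_controlled`), and the hypotheses on
the exponents say exactly that this σ is large enough.

The rate depends only on Hölder bounds, so the sums converge uniformly in the simplex and in `g`
(`exists_dist_stratSum_lt`). Continuity in the vertices and in `g`, as well as the alternating
property, pass to the limit. For a flat simplex, `g` is averaged along the carrying line. It becomes
C^{1,β} there, which makes the determinant of order 2 + β > 2 and forces the integral to vanish;
continuity in `g` removes the averaging (`nonatomic_stratIntegral`). -/

/-- The transpose of the dyadic decomposition, acting on germs. -/
noncomputable def dyaGerm (ω : Germ2) : Germ2 := fun S =>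
  ω ![midpoint ℝ (S 1) (S 2), midpoint ℝ (S 0) (S 2), midpoint ℝ (S 0) (S 1)]
    + ω ![midpoint ℝ (S 0) (S 2), midpoint ℝ (S 1) (S 2), S 2]
    + ω ![midpoint ℝ (S 0) (S 1), S 1, midpoint ℝ (S 1) (S 2)]
    + ω ![S 0, midpoint ℝ (S 0) (S 1), midpoint ℝ (S 0) (S 2)]

lemma pairing_eq_linearCombination (c : Chain2) (ω : Germ2) :
    pairing c ω = Finsupp.linearCombination ℝ ω c := rfl

/-- By this duality the subdivision can be moved from chains to germs, where the size estimates
live. -/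
lemma pairing_dya (c : Chain2) (ω : Germ2) : pairing (dya c) ω = pairing c (dyaGerm ω) := by
  simp only [pairing_eq_linearCombination, dya]
  induction c using Finsupp.induction_linear with
  | zero => simp
  | add x y hx hy => simp only [map_add, hx, hy]
  | single S a => simp [dyaSimplex, dyaGerm, mul_add]

lemma pairing_dya_iterate (n : ℕ) (c : Chain2) (ω : Germ2) :
    pairing (dya^[n] c) ω = pairing c (dyaGerm^[n] ω) := by
  induction n generalizing ω with
  | zero => rfl
  | succ n ih => rw [Function.iterate_succ_apply', pairing_dya, ih, Function.iterate_succ_apply]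

lemma stratSum_eq (f g1 g2 : Plane → ℝ) (n : ℕ) :
    stratSum f g1 g2 n = dyaGerm^[n] (strat f g1 g2) := by
  funext S
  rw [stratSum, pairing_dya_iterate]
  simp [pairing]

lemma dyaGerm_add (ω ω' : Germ2) : dyaGerm (ω + ω') = dyaGerm ω + dyaGerm ω' := by
  funext S
  simp only [dyaGerm, Pi.add_apply]
  ring

lemma dyaGerm_iterate_add (n : ℕ) (ω ω' : Germ2) :
    dyaGerm^[n] (ω + ω') = dyaGerm^[n] ω + dyaGerm^[n] ω' := by
  induction n generalizing ω ω' with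
  | zero => rfl
  | succ n ih => simp only [Function.iterate_succ_apply, dyaGerm_add, ih]

lemma continuous_dyaGerm {ω : Germ2} (hω : Continuous ω) : Continuous (dyaGerm ω) := by
  have hm (i j : Fin 3) : Continuous fun S : Simp2 => midpoint ℝ (S i) (S j) := by
    simp only [midpoint_eq_smul_add]
    fun_prop
  have hc (a b c : Simp2 → Plane) (ha : Continuous a) (hb : Continuous b) (hc : Continuous c) :
      Continuous fun S => ω ![a S, b S, c S] := by
    refine hω.comp (continuous_pi fun i => ?_)
    fin_cases i <;> simpa
  have hp (i : Fin 3) : Continuous fun S : Simp2 => S i := continuous_apply i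
  exact (((hc _ _ _ (hm _ _) (hm _ _) (hm _ _)).add (hc _ _ _ (hm _ _) (hm _ _) (hp _))).add
    (hc _ _ _ (hm _ _) (hp _) (hm _ _))).add (hc _ _ _ (hp _) (hm _ _) (hm _ _))

lemma eq_vec (S : Simp2) : S = ![S 0, S 1, S 2] := by
  funext i
  fin_cases i <;> rfl

/-- An alternating germ is determined by its behaviour under two transpositions. -/
lemma alternating_iff (ω : Germ2) :
    Alternating ω ↔ ∀ p q r, ω ![q, p, r] = -ω ![p, q, r] ∧ ω ![p, r, q] = -ω ![p, q, r] := by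
  constructor
  · intro h p q r
    have h01 := h (Equiv.swap 0 1) ![p, q, r]
    have h12 := h (Equiv.swap 1 2) ![p, q, r]
    rw [eq_vec (fun i => _)] at h01 h12
    rw [Equiv.Perm.sign_swap (by decide)] at h01 h12
    constructor
    · simpa [Equiv.swap_apply_of_ne_of_ne] using h01
    · simpa [Equiv.swap_apply_of_ne_of_ne] using h12
  · intro h
    have hswap (S : Simp2) : ω (fun i => S (Equiv.swap 0 1 i)) = -ω S ∧
        ω (fun i => S (Equiv.swap 1 2 i)) = -ω S := by
      have := h (S 0) (S 1) (S 2)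
      rw [← eq_vec] at this
      constructor
      · rw [← this.1]; congr 1; funext i; fin_cases i <;> rfl
      · rw [← this.2]; congr 1; funext i; fin_cases i <;> rfl
    intro σ
    -- The adjacent transpositions generate the symmetric group, and both sides are multiplicative
    -- in σ.
    have hmem : σ ∈ Submonoid.closure
        (Set.range fun i : Fin 2 => Equiv.swap i.castSucc i.succ) := by
      rw [Equiv.Perm.mclosure_swap_castSucc_succ]
      trivial
    induction hmem using Submonoid.closure_induction with
    | mem σ hσ =>
      obtain ⟨i, rfl⟩ := hσ
      intro S
      dsimp only
      rw [Equiv.Perm.sign_swap (Fin.castSucc_lt_succ.ne)]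
      fin_cases i
      · simpa using (hswap S).1
      · simpa using (hswap S).2
    | one => simp
    | mul σ τ _ _ hσ hτ =>
      intro S
      refine (hτ fun j => S (σ j)).trans ?_
      rw [hσ]
      simp only [Equiv.Perm.sign_mul, Units.val_mul, Int.cast_mul]
      ring

/-- A transposition of the vertices permutes the four pieces and reverses the orientation of each.
-/
lemma alternating_dyaGerm {ω : Germ2} (hω : Alternating ω) : Alternating (dyaGerm ω) := by
  rw [alternating_iff] at hω ⊢
  intro p q r
  simp only [dyaGerm, Matrix.cons_val]
  rw [midpoint_comm q p, midpoint_comm r q]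
  set a := midpoint ℝ p q
  set b := midpoint ℝ p r
  set c := midpoint ℝ q r
  constructor
  · linarith [(hω c b a).1, (hω b c r).1, (hω a p b).1, (hω p a b).1, (hω p a b).2,
      (hω p b a).1, (hω a q c).1, (hω a q c).2, (hω q a c).1, (hω q a c).2, (hω q c a).1,
      (hω a p b).2]
  · linarith [(hω c b a).1, (hω c b a).2, (hω c a b).1, (hω c a b).2, (hω a c b).1, (hω a c b).2,
      (hω b c r).1, (hω b c r).2, (hω b r c).1, (hω b r c).2, (hω a q c).1, (hω a q c).2,
      (hω a c q).1, (hω a c q).2, (hω c a q).1, (hω c b r).1, (hω c b r).2, (hω p a b).1,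
      (hω p a b).2]

/-! ### Edge germs and coboundaries -/

/-- The dyadic subdivision of edges, acting on functions of oriented edges. -/
noncomputable def dyaEdge (η : Plane → Plane → ℝ) : Plane → Plane → ℝ := fun p q =>
  η p (midpoint ℝ p q) + η (midpoint ℝ p q) q

/-- The coboundary of a function of oriented edges. -/
def cob (η : Plane → Plane → ℝ) : Germ2 := fun S =>
  η (S 0) (S 1) + η (S 1) (S 2) + η (S 2) (S 0)

lemma dyaEdge_antisymm {η : Plane → Plane → ℝ} (hη : ∀ p q, η q p = -η p q) (p q : Plane) :
    dyaEdge η q p = -dyaEdge η p q := by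
  rw [dyaEdge, dyaEdge, midpoint_comm q p, hη p, hη _ q]
  ring

/-- Each edge of the middle triangle is shared with one corner triangle in the opposite orientation,
so only the halved outer sides survive. This replaces the factor 4 per subdivision by a factor 2. -/
lemma dyaGerm_cob {η : Plane → Plane → ℝ} (hη : ∀ p q, η q p = -η p q) :
    dyaGerm (cob η) = cob (dyaEdge η) := by
  funext S
  simp only [dyaGerm, cob, dyaEdge, Matrix.cons_val]
  rw [midpoint_comm (S 2) (S 0)]
  set a := midpoint ℝ (S 0) (S 1)
  set b := midpoint ℝ (S 0) (S 2)
  set c := midpoint ℝ (S 1) (S 2)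
  linarith [hη a b, hη b c, hη a c]

lemma dyaGerm_iterate_cob {η : Plane → Plane → ℝ} (hη : ∀ p q, η q p = -η p q) (n : ℕ) :
    dyaGerm^[n] (cob η) = cob (dyaEdge^[n] η) := by
  induction n generalizing η with
  | zero => rfl
  | succ n ih =>
    rw [Function.iterate_succ_apply, dyaGerm_cob hη, ih (dyaEdge_antisymm hη),
      Function.iterate_succ_apply]

/-! ### Size estimates -/

/-- `|ω S| ≤ C D ^ κ` for the simplices `S` with vertices in `s` and sides of length at
most `D`. -/
def GermBound (s : Set Plane) (κ C : ℝ) (ω : Germ2) : Prop :=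
  ∀ (S : Simp2) (D : ℝ), (∀ i, S i ∈ s) → (∀ i j, dist (S i) (S j) ≤ D) → |ω S| ≤ C * D ^ κ

/-- `|η p q| ≤ C |p - q| ^ κ` for the edges with endpoints in `s`. -/
def EdgeBound (s : Set Plane) (κ C : ℝ) (η : Plane → Plane → ℝ) : Prop :=
  ∀ p ∈ s, ∀ q ∈ s, |η p q| ≤ C * dist p q ^ κ

lemma dist_midpoint_midpoint_left (a p q : Plane) :
    dist (midpoint ℝ a p) (midpoint ℝ a q) = dist p q / 2 := by
  rw [dist_eq_norm, dist_eq_norm, midpoint_eq_smul_add, midpoint_eq_smul_add, ← smul_sub,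
    add_sub_add_left_eq_sub, norm_smul]
  norm_num
  ring

/-- There are four pieces, and all their sides are at most D/2. -/
lemma GermBound.dyaGerm {s : Set Plane} (hs : Convex ℝ s) {κ C : ℝ} {ω : Germ2}
    (h : GermBound s κ C ω) : GermBound s κ (4 / 2 ^ κ * C) (dyaGerm ω) := by
  intro S D hS hD
  have hD0 : 0 ≤ D := dist_nonneg.trans (hD 0 0)
  have hm (i j : Fin 3) : midpoint ℝ (S i) (S j) ∈ s := hs.midpoint_mem (hS i) (hS j)
  have key (a b c : Plane) (ha : a ∈ s) (hb : b ∈ s) (hc : c ∈ s) (hab : dist a b ≤ D / 2)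
      (hac : dist a c ≤ D / 2) (hbc : dist b c ≤ D / 2) :
      |ω ![a, b, c]| ≤ C * (D / 2) ^ κ := by
    refine h _ _ (fun i => by fin_cases i <;> assumption) fun i j => ?_
    have : 0 ≤ D / 2 := by positivity
    fin_cases i <;> fin_cases j <;> simp [dist_comm] <;> assumption
  have h01 : dist (midpoint ℝ (S 0) (S 2)) (midpoint ℝ (S 1) (S 2)) ≤ D / 2 := by
    rw [midpoint_comm (S 0), midpoint_comm (S 1), dist_midpoint_midpoint_left]
    linarith [hD 0 1]
  have h02 : dist (midpoint ℝ (S 0) (S 1)) (midpoint ℝ (S 1) (S 2)) ≤ D / 2 := by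
    rw [midpoint_comm (S 0), dist_midpoint_midpoint_left]
    linarith [hD 0 2]
  have h12 : dist (midpoint ℝ (S 0) (S 1)) (midpoint ℝ (S 0) (S 2)) ≤ D / 2 := by
    rw [dist_midpoint_midpoint_left]
    linarith [hD 1 2]
  have hl (i j : Fin 3) : dist (S i) (midpoint ℝ (S i) (S j)) ≤ D / 2 := by
    rw [dist_left_midpoint]
    norm_num
    linarith [hD i j]
  have hr (i j : Fin 3) : dist (midpoint ℝ (S i) (S j)) (S j) ≤ D / 2 := by
    rw [dist_midpoint_right]
    norm_num
    linarith [hD i j]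
  have e1 := key _ _ _ (hm 1 2) (hm 0 2) (hm 0 1) (by rwa [dist_comm]) (by rwa [dist_comm])
    (by rwa [dist_comm])
  have e2 := key _ _ _ (hm 0 2) (hm 1 2) (hS 2) h01 (hr 0 2) (hr 1 2)
  have e3 := key _ _ _ (hm 0 1) (hS 1) (hm 1 2) (hr 0 1) h02 (hl 1 2)
  have e4 := key _ _ _ (hS 0) (hm 0 1) (hm 0 2) (hl 0 1) (hl 0 2) h12
  have hpow : 4 / 2 ^ κ * C * D ^ κ = 4 * (C * (D / 2) ^ κ) := by
    rw [Real.div_rpow hD0 zero_le_two]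
    ring
  rw [hpow, RoughForm.dyaGerm]
  refine (abs_add_le _ _).trans ?_
  linarith [abs_add_three (ω ![midpoint ℝ (S 1) (S 2), midpoint ℝ (S 0) (S 2), midpoint ℝ (S 0) (S 1)])
    (ω ![midpoint ℝ (S 0) (S 2), midpoint ℝ (S 1) (S 2), S 2])
    (ω ![midpoint ℝ (S 0) (S 1), S 1, midpoint ℝ (S 1) (S 2)])]

lemma GermBound.dyaGerm_iterate {s : Set Plane} (hs : Convex ℝ s) {κ C : ℝ} {ω : Germ2}
    (h : GermBound s κ C ω) (n : ℕ) :
    GermBound s κ ((4 / 2 ^ κ) ^ n * C) (RoughForm.dyaGerm^[n] ω) := by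
  induction n with
  | zero => simpa using h
  | succ n ih =>
    rw [Function.iterate_succ_apply', pow_succ', mul_assoc]
    exact ih.dyaGerm hs

lemma EdgeBound.dyaEdge {s : Set Plane} (hs : Convex ℝ s) {κ C : ℝ} {η : Plane → Plane → ℝ}
    (h : EdgeBound s κ C η) : EdgeBound s κ (2 / 2 ^ κ * C) (dyaEdge η) := by
  intro p hp q hq
  have hm := hs.midpoint_mem hp hq
  have e1 := h p hp _ hm
  have e2 := h _ hm q hq
  rw [dist_left_midpoint] at e1
  rw [dist_midpoint_right] at e2
  have hpow : 2 / 2 ^ κ * C * dist p q ^ κ = 2 * (C * (‖(2 : ℝ)‖⁻¹ * dist p q) ^ κ) := by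
    rw [Real.mul_rpow (by positivity) dist_nonneg, Real.norm_two, Real.inv_rpow zero_le_two]
    ring
  rw [hpow, RoughForm.dyaEdge]
  linarith [abs_add_le (η p (midpoint ℝ p q)) (η (midpoint ℝ p q) q)]

lemma EdgeBound.dyaEdge_iterate {s : Set Plane} (hs : Convex ℝ s) {κ C : ℝ}
    {η : Plane → Plane → ℝ} (h : EdgeBound s κ C η) (n : ℕ) :
    EdgeBound s κ ((2 / 2 ^ κ) ^ n * C) (RoughForm.dyaEdge^[n] η) := by
  induction n with
  | zero => simpa using h
  | succ n ih =>
    rw [Function.iterate_succ_apply', pow_succ', mul_assoc]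
    exact ih.dyaEdge hs

/-! ### The Stratonovich germ -/

lemma strat_apply (f g1 g2 : Plane → ℝ) (S : Simp2) :
    strat f g1 g2 S = 1 / 2 * ((f (S 0) + f (S 1) + f (S 2)) / 3) *
      ((g1 (S 1) - g1 (S 0)) * (g2 (S 2) - g2 (S 0)) -
        (g1 (S 2) - g1 (S 0)) * (g2 (S 1) - g2 (S 0))) := by
  rw [strat, Matrix.det_fin_two_of]

lemma alternating_strat (f g1 g2 : Plane → ℝ) : Alternating (strat f g1 g2) := by
  rw [alternating_iff]
  intro p q r
  simp only [strat_apply, Matrix.cons_val]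
  constructor <;> ring

lemma continuous_strat {f g1 g2 : Plane → ℝ} (hf : Continuous f) (h1 : Continuous g1)
    (h2 : Continuous g2) : Continuous (strat f g1 g2) := by
  rw [funext (strat_apply f g1 g2)]
  fun_prop

lemma abs_strat_le {f g1 g2 : Plane → ℝ} {S : Simp2} {ε A B : ℝ} (hf : ∀ i, |f (S i)| ≤ ε)
    (h1 : ∀ i j, |g1 (S i) - g1 (S j)| ≤ A) (h2 : ∀ i j, |g2 (S i) - g2 (S j)| ≤ B) :
    |strat f g1 g2 S| ≤ ε * (A * B) := by
  have hA : 0 ≤ A := (abs_nonneg _).trans (h1 0 0)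
  have hε : 0 ≤ ε := (abs_nonneg _).trans (hf 0)
  have hav : |(f (S 0) + f (S 1) + f (S 2)) / 3| ≤ ε := by
    rw [abs_div, abs_of_pos (by norm_num : (0 : ℝ) < 3), div_le_iff₀ (by norm_num)]
    linarith [abs_add_three (f (S 0)) (f (S 1)) (f (S 2)), hf 0, hf 1, hf 2]
  have hdet : |(g1 (S 1) - g1 (S 0)) * (g2 (S 2) - g2 (S 0)) -
      (g1 (S 2) - g1 (S 0)) * (g2 (S 1) - g2 (S 0))| ≤ 2 * (A * B) := by
    refine (abs_sub _ _).trans ?_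
    rw [abs_mul, abs_mul]
    have e1 := mul_le_mul (h1 1 0) (h2 2 0) (abs_nonneg _) hA
    have e2 := mul_le_mul (h1 2 0) (h2 1 0) (abs_nonneg _) hA
    linarith
  rw [strat_apply, abs_mul, abs_mul, abs_of_pos (by norm_num : (0 : ℝ) < 1 / 2)]
  have := mul_le_mul hav hdet (abs_nonneg _) hε
  linarith

/-- The Stratonovich germ on the flat simplex given by an edge and its midpoint. -/
noncomputable def stratEdge (f g1 g2 : Plane → ℝ) : Plane → Plane → ℝ := fun p q =>
  strat f g1 g2 ![p, midpoint ℝ p q, q]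

lemma stratEdge_antisymm (f g1 g2 : Plane → ℝ) (p q : Plane) :
    stratEdge f g1 g2 q p = -stratEdge f g1 g2 p q := by
  simp only [stratEdge, strat_apply, Matrix.cons_val, midpoint_comm q p]
  ring

/-- The defect of additivity of the Stratonovich germ under dyadic subdivision, corrected by
the boundary terms. -/
noncomputable def stratDefect (f g1 g2 : Plane → ℝ) : Germ2 := fun S =>
  dyaGerm (strat f g1 g2) S - strat f g1 g2 S - cob (stratEdge f g1 g2) S

/-- Stokes' theorem for integrands which are affine functions of `(g1, g2)`. -/
lemma stratDefect_affine (g1 g2 : Plane → ℝ) (a b1 b2 : ℝ) (S : Simp2) :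
    stratDefect (fun x => a + b1 * g1 x + b2 * g2 x) g1 g2 S = 0 := by
  -- The signed image triangles (four small, minus the large one, minus three on the sides) have
  -- total boundary zero, and on each of them an affine density integrates exactly to vertex average
  -- times signed area.
  simp only [stratDefect, dyaGerm, cob, stratEdge, strat_apply, Matrix.cons_val]
  rw [midpoint_comm (S 2) (S 0)]
  ring

lemma stratDefect_sub (f f' g1 g2 : Plane → ℝ) (S : Simp2) :
    stratDefect (fun x => f x - f' x) g1 g2 S =
      stratDefect f g1 g2 S - stratDefect f' g1 g2 S := by
  simp only [stratDefect, dyaGerm, cob, stratEdge, strat_apply, Matrix.cons_val]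
  ring

/-- The pair `(g1, g2)` is Hölder on `s`, and `f` is bounded on `s` and approximated, around
each point and up to an error of order `σ`, by affine functions of `(g1, g2)`. -/
structure Controlled (s : Set Plane) (β₁ β₂ σ C : ℝ) (f g1 g2 : Plane → ℝ) : Prop where
  holder_fst : ∀ p ∈ s, ∀ q ∈ s, |g1 p - g1 q| ≤ C * dist p q ^ β₁
  holder_snd : ∀ p ∈ s, ∀ q ∈ s, |g2 p - g2 q| ≤ C * dist p q ^ β₂
  bound : ∀ p ∈ s, |f p| ≤ C
  approx : ∀ p ∈ s, ∃ a b1 b2 : ℝ, ∀ q ∈ s,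
    |f q - (a + b1 * g1 q + b2 * g2 q)| ≤ C * dist p q ^ σ

variable {s : Set Plane} {β₁ β₂ σ C : ℝ} {f g1 g2 : Plane → ℝ}

lemma Controlled.abs_strat_le (h : Controlled s β₁ β₂ σ C f g1 g2) (hC : 0 ≤ C) (hβ₁ : 0 ≤ β₁)
    (hβ₂ : 0 ≤ β₂) {f' : Plane → ℝ} {S : Simp2} {D ε : ℝ} (hS : ∀ i, S i ∈ s)
    (hD : ∀ i j, dist (S i) (S j) ≤ D) (hf : ∀ i, |f' (S i)| ≤ ε) :
    |strat f' g1 g2 S| ≤ ε * (C ^ 2 * D ^ (β₁ + β₂)) := by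
  have hD0 : 0 ≤ D := dist_nonneg.trans (hD 0 0)
  refine (RoughForm.abs_strat_le (A := C * D ^ β₁) (B := C * D ^ β₂) hf
    (fun i j => (h.holder_fst _ (hS i) _ (hS j)).trans ?_)
    (fun i j => (h.holder_snd _ (hS i) _ (hS j)).trans ?_)).trans_eq ?_
  · gcongr
    exact hD i j
  · gcongr
    exact hD i j
  · rw [Real.rpow_add_of_nonneg hD0 hβ₁ hβ₂]
    ring

lemma dist_vec_midpoint_le (p q : Plane) (i j : Fin 3) :
    dist ((![p, midpoint ℝ p q, q] : Simp2) i) ((![p, midpoint ℝ p q, q] : Simp2) j)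
      ≤ dist p q := by
  have h1 : dist p (midpoint ℝ p q) ≤ dist p q := by
    rw [dist_left_midpoint]
    norm_num
    linarith [dist_nonneg (x := p) (y := q)]
  have h2 : dist (midpoint ℝ p q) q ≤ dist p q := by
    rw [dist_midpoint_right]
    norm_num
    linarith [dist_nonneg (x := p) (y := q)]
  rw [dist_comm] at h1 h2
  fin_cases i <;> fin_cases j <;> simp [dist_comm] at * <;> assumption

lemma Controlled.edgeBound_stratEdge (h : Controlled s β₁ β₂ σ C f g1 g2) (hs : Convex ℝ s)
    (hC : 0 ≤ C) (hβ₁ : 0 ≤ β₁) (hβ₂ : 0 ≤ β₂) :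
    EdgeBound s (β₁ + β₂) (C ^ 3) (stratEdge f g1 g2) := by
  intro p hp q hq
  have hmem (i) : (![p, midpoint ℝ p q, q] : Simp2) i ∈ s := by
    have := hs.midpoint_mem hp hq
    fin_cases i <;> simpa
  refine (h.abs_strat_le hC hβ₁ hβ₂ hmem (dist_vec_midpoint_le p q)
    fun i => h.bound _ (hmem i)).trans_eq ?_
  ring

/-- The germ estimate behind the convergence of the Stratonovich sums. -/
lemma Controlled.germBound_stratDefect (h : Controlled s β₁ β₂ σ C f g1 g2) (hs : Convex ℝ s)
    (hC : 0 ≤ C) (hβ₁ : 0 ≤ β₁) (hβ₂ : 0 ≤ β₂) (hσ : 0 ≤ σ) :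
    GermBound s (σ + (β₁ + β₂)) (8 * C ^ 3) (stratDefect f g1 g2) := by
  intro S D hS hD
  have hD0 : 0 ≤ D := dist_nonneg.trans (hD 0 0)
  obtain ⟨a, b1, b2, hL⟩ := h.approx _ (hS 0)
  -- The defect is linear in the integrand and vanishes on affine ones, so the affine approximation
  -- at `S 0` can be subtracted.
  set f' : Plane → ℝ := fun x => f x - (a + b1 * g1 x + b2 * g2 x) with hf'
  have hdef : stratDefect f g1 g2 S = stratDefect f' g1 g2 S := by
    rw [hf', stratDefect_sub, stratDefect_affine, sub_zero]
  -- Localizing to the ball of radius `D` makes `f'` of size D^σ; convexity keeps the midpoints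
  -- inside.
  set t : Set Plane := s ∩ closedBall (S 0) D
  have ht : Convex ℝ t := hs.inter (convex_closedBall _ _)
  have hSt (i) : S i ∈ t := ⟨hS i, hD i 0⟩
  have hft (x) (hx : x ∈ t) : |f' x| ≤ C * D ^ σ := by
    refine (hL x hx.1).trans ?_
    have := hx.2
    rw [mem_closedBall, dist_comm] at this
    gcongr
  have hω : GermBound t (β₁ + β₂) (C ^ 3 * D ^ σ) (strat f' g1 g2) := by
    intro T E hT hE
    refine (h.abs_strat_le hC hβ₁ hβ₂ (fun i => (hT i).1) hE fun i => hft _ (hT i)).trans_eq ?_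
    ring
  have hη : EdgeBound t (β₁ + β₂) (C ^ 3 * D ^ σ) (stratEdge f' g1 g2) := by
    intro p hp q hq
    refine hω _ _ (fun i => ?_) (dist_vec_midpoint_le p q)
    have := ht.midpoint_mem hp hq
    fin_cases i <;> simpa
  have e0 := hω S D hSt hD
  have e1 := (hω.dyaGerm ht) S D hSt hD
  have hE (i j : Fin 3) : |stratEdge f' g1 g2 (S i) (S j)| ≤
      C ^ 3 * D ^ σ * D ^ (β₁ + β₂) := by
    refine (hη _ (hSt i) _ (hSt j)).trans ?_
    gcongr
    exact hD i j
  have hpos : 0 ≤ C ^ 3 * D ^ σ * D ^ (β₁ + β₂) := by positivity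
  have e1' : 4 / 2 ^ (β₁ + β₂) * (C ^ 3 * D ^ σ) * D ^ (β₁ + β₂) ≤
      4 * (C ^ 3 * D ^ σ * D ^ (β₁ + β₂)) := by
    rw [mul_assoc]
    refine mul_le_mul_of_nonneg_right (div_le_self (by norm_num) ?_) hpos
    exact Real.one_le_rpow one_le_two (by positivity)
  rw [hdef, stratDefect, cob, Real.rpow_add_of_nonneg hD0 hσ (by positivity)]
  refine (abs_sub _ _).trans ?_
  -- The constant 8 is 4 + 1 + 3: the subdivided germ, the germ itself and the three sides.
  linarith [abs_sub (dyaGerm (strat f' g1 g2) S) (strat f' g1 g2 S), hE 0 1, hE 1 2, hE 2 0,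
    abs_add_three (stratEdge f' g1 g2 (S 0) (S 1)) (stratEdge f' g1 g2 (S 1) (S 2))
      (stratEdge f' g1 g2 (S 2) (S 0))]

/-- Successive Stratonovich sums differ by a geometrically small amount, which depends on the
data only through the constants. -/
lemma Controlled.abs_stratSum_succ_sub_le (h : Controlled s β₁ β₂ σ C f g1 g2)
    (hs : Convex ℝ s) (hC : 0 ≤ C) (hβ₁ : 0 ≤ β₁) (hβ₂ : 0 ≤ β₂) (hσ : 0 ≤ σ) {S : Simp2} {D : ℝ}
    (hS : ∀ i, S i ∈ s) (hD : ∀ i j, dist (S i) (S j) ≤ D) (n : ℕ) :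
    |stratSum f g1 g2 (n + 1) S - stratSum f g1 g2 n S| ≤
      (8 * C ^ 3 * D ^ (σ + (β₁ + β₂)) + 3 * C ^ 3 * D ^ (β₁ + β₂)) *
        max (4 / 2 ^ (σ + (β₁ + β₂))) (2 / 2 ^ (β₁ + β₂)) ^ n := by
  have hD0 : 0 ≤ D := dist_nonneg.trans (hD 0 0)
  -- Iterating this one-step identity n times, the difference of successive sums becomes an edge
  -- part and a defect part, which scale separately.
  have hdec : dyaGerm (strat f g1 g2) =
      strat f g1 g2 + (cob (stratEdge f g1 g2) + stratDefect f g1 g2) := by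
    funext T
    simp only [Pi.add_apply, stratDefect]
    ring
  rw [stratSum_eq, stratSum_eq, Function.iterate_succ_apply, hdec, dyaGerm_iterate_add,
    dyaGerm_iterate_add, dyaGerm_iterate_cob (stratEdge_antisymm f g1 g2)]
  simp only [Pi.add_apply, add_sub_cancel_left]
  set θ := max (4 / 2 ^ (σ + (β₁ + β₂)) : ℝ) (2 / 2 ^ (β₁ + β₂))
  have e1 := ((h.germBound_stratDefect hs hC hβ₁ hβ₂ hσ).dyaGerm_iterate hs n) S D hS hD
  have e2 (i j : Fin 3) : |(dyaEdge^[n] (stratEdge f g1 g2)) (S i) (S j)| ≤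
      θ ^ n * (C ^ 3 * D ^ (β₁ + β₂)) := by
    refine (((h.edgeBound_stratEdge hs hC hβ₁ hβ₂).dyaEdge_iterate hs n) _ (hS i) _ (hS j)).trans ?_
    rw [mul_assoc]
    gcongr
    · exact le_max_right _ _
    · exact hD i j
  have e1' : (4 / 2 ^ (σ + (β₁ + β₂)) : ℝ) ^ n * (8 * C ^ 3) * D ^ (σ + (β₁ + β₂)) ≤
      θ ^ n * (8 * C ^ 3 * D ^ (σ + (β₁ + β₂))) := by
    rw [mul_assoc]
    gcongr
    exact le_max_left _ _
  refine (abs_add_le _ _).trans ?_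
  rw [cob]
  linarith [e2 0 1, e2 1 2, e2 2 0, abs_add_three
    ((dyaEdge^[n] (stratEdge f g1 g2)) (S 0) (S 1))
    ((dyaEdge^[n] (stratEdge f g1 g2)) (S 1) (S 2))
    ((dyaEdge^[n] (stratEdge f g1 g2)) (S 2) (S 0))]

/-- `A` and `θ` are chosen before the functions and the simplex; all the later uniformity rests on
this. `R + R` bounds the diameter of the ball. -/
lemma exists_rate {β₁ β₂ σ : ℝ} (hβ₁ : 0 ≤ β₁) (hβ₂ : 0 ≤ β₂) (hσ : 0 ≤ σ) (hβ : 1 < β₁ + β₂)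
    (hσβ : 2 < σ + (β₁ + β₂)) {C : ℝ} (hC : 0 ≤ C) (R : ℝ) :
    ∃ A θ : ℝ, 0 ≤ θ ∧ θ < 1 ∧ ∀ f g1 g2 : Plane → ℝ,
      Controlled (closedBall 0 R) β₁ β₂ σ C f g1 g2 → ∀ S : Simp2, (∀ i, S i ∈ closedBall 0 R) →
        ∀ n, dist (stratSum f g1 g2 n S) (stratSum f g1 g2 (n + 1) S) ≤ A * θ ^ n := by
  refine ⟨8 * C ^ 3 * (R + R) ^ (σ + (β₁ + β₂)) + 3 * C ^ 3 * (R + R) ^ (β₁ + β₂),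
    max (4 / 2 ^ (σ + (β₁ + β₂))) (2 / 2 ^ (β₁ + β₂)), by positivity, max_lt ?_ ?_,
    fun f g1 g2 h S hS n => ?_⟩
  rotate_left 2
  · rw [dist_comm, Real.dist_eq]
    refine h.abs_stratSum_succ_sub_le (convex_closedBall _ _) hC hβ₁ hβ₂ hσ hS (D := R + R)
      (fun i j => ?_) n
    exact (dist_triangle_right _ _ 0).trans (add_le_add (hS i) (hS j))
  · rw [div_lt_one (by positivity)]
    calc (4 : ℝ) = 2 ^ (2 : ℝ) := by norm_num
      _ < _ := Real.rpow_lt_rpow_of_exponent_lt one_lt_two hσβ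
  · rw [div_lt_one (by positivity)]
    calc (2 : ℝ) = 2 ^ (1 : ℝ) := by norm_num
      _ < _ := Real.rpow_lt_rpow_of_exponent_lt one_lt_two hβ

/-! ### Uniform Hölder bounds over bounded sets -/

/-- Continuity into a Hölder space gives a bound near each parameter; finitely many such
neighbourhoods cover a compact set. -/
lemma exists_uniform_bound_of_isCompact {X : Type*} [TopologicalSpace X] {K : Set X}
    (hK : IsCompact K) {P : ℝ → X → Prop} (hmono : ∀ C C' x, C ≤ C' → P C x → P C' x)
    (hloc : ∀ x, ∃ C, ∀ᶠ y in 𝓝 x, P C y) : ∃ C, ∀ x ∈ K, P C x := by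
  refine hK.induction_on (p := fun s => ∃ C, ∀ x ∈ s, P C x) ⟨0, by simp⟩ ?_ ?_ ?_
  · rintro s t hst ⟨C, hC⟩
    exact ⟨C, fun x hx => hC x (hst hx)⟩
  · rintro s t ⟨C, hC⟩ ⟨C', hC'⟩
    refine ⟨max C C', fun x hx => ?_⟩
    rcases hx with hx | hx
    · exact hmono _ _ _ (le_max_left _ _) (hC x hx)
    · exact hmono _ _ _ (le_max_right _ _) (hC' x hx)
  · intro x _
    obtain ⟨C, hC⟩ := hloc x
    exact ⟨_, mem_nhdsWithin_of_mem_nhds hC, C, fun y hy => hy⟩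

section Holder

variable {Y : Type*} [NormedAddCommGroup Y] {α : ℝ≥0} {s : Set Plane} {f f' : Plane → Y}

lemma exists_holder_of_holderNormOn_lt_top (h : holderNormOn α s f < ⊤) :
    ∃ C : ℝ, 0 ≤ C ∧ ∀ x ∈ s, ‖f x‖ ≤ C ∧ ∀ y ∈ s, ‖f x - f y‖ ≤ C * dist x y ^ (α : ℝ) := by
  obtain ⟨h1, h2⟩ := ENNReal.add_lt_top.1 h
  obtain ⟨C, hC⟩ := eHolderNorm_lt_top.1 h2
  refine ⟨max (⨆ x ∈ s, ‖f x‖ₑ).toReal C, by positivity, fun x hx => ⟨?_, fun y hy => ?_⟩⟩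
  · refine le_max_of_le_left ?_
    rw [← toReal_enorm]
    exact ENNReal.toReal_mono h1.ne (le_iSup₂_of_le x hx le_rfl)
  · rw [← dist_eq_norm]
    refine (hC.dist_le ⟨x, hx⟩ ⟨y, hy⟩).trans ?_
    gcongr
    · exact le_max_right _ _
    · exact le_rfl

lemma holder_of_holderNormOn_le_one (h : holderNormOn α s f ≤ 1) :
    ∀ x ∈ s, ‖f x‖ ≤ 1 ∧ ∀ y ∈ s, ‖f x - f y‖ ≤ dist x y ^ (α : ℝ) := by
  have h1 : (⨆ x ∈ s, ‖f x‖ₑ) ≤ 1 := le_self_add.trans h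
  have h2 : eHolderNorm α (s.domRestrict f) ≤ 1 := le_add_self.trans h
  refine fun x hx => ⟨?_, fun y hy => ?_⟩
  · rw [← toReal_enorm]
    exact ENNReal.toReal_le_of_le_ofReal zero_le_one
      (by simpa using (le_iSup₂_of_le (f := fun x _ => ‖f x‖ₑ) x hx le_rfl).trans h1)
  · rw [← dist_eq_norm]
    have hmem : MemHolder α (s.domRestrict f) :=
      eHolderNorm_lt_top.1 (h2.trans_lt ENNReal.one_lt_top)
    refine (hmem.holderWith.dist_le ⟨x, hx⟩ ⟨y, hy⟩).trans ?_
    have : nnHolderNorm α (s.domRestrict f) ≤ 1 := by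
      rw [← ENNReal.coe_le_coe, hmem.coe_nnHolderNorm_eq_eHolderNorm]
      exact_mod_cast h2
    refine mul_le_of_le_one_left (by positivity) (by exact_mod_cast this)

lemma exists_holder_near (Φ : Plane → Plane → Y) (u₀ : Plane) (h₀ : holderNormOn α s (Φ u₀) < ⊤)
    (h : ∀ᶠ u in 𝓝 u₀, holderNormOn α s (Φ u - Φ u₀) ≤ 1) :
    ∃ C : ℝ, ∀ᶠ u in 𝓝 u₀, ∀ x ∈ s, ‖Φ u x‖ ≤ C ∧
      ∀ y ∈ s, ‖Φ u x - Φ u y‖ ≤ C * dist x y ^ (α : ℝ) := by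
  obtain ⟨C, -, hC⟩ := exists_holder_of_holderNormOn_lt_top h₀
  refine ⟨C + 1, h.mono fun u hu x hx => ⟨?_, fun y hy => ?_⟩⟩
  · have h1 := (holder_of_holderNormOn_le_one hu x hx).1
    have := norm_add_le (Φ u₀ x) ((Φ u - Φ u₀) x)
    rw [Pi.sub_apply, add_sub_cancel] at this
    rw [Pi.sub_apply] at h1
    linarith [(hC x hx).1]
  · have h1 := (holder_of_holderNormOn_le_one hu x hx).2 y hy
    have h2 := (hC x hx).2 y hy
    have h3 : Φ u x - Φ u y = (Φ u₀ x - Φ u₀ y) + ((Φ u - Φ u₀) x - (Φ u - Φ u₀) y) := by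
      simp only [Pi.sub_apply]
      abel
    rw [h3]
    linarith [norm_add_le (Φ u₀ x - Φ u₀ y) ((Φ u - Φ u₀) x - (Φ u - Φ u₀) y)]

lemma exists_uniform_holder {Φ : Plane → Plane → Y} (h₀ : ∀ u, holderNormOn α s (Φ u) < ⊤)
    (h : ∀ u₀, ∀ᶠ u in 𝓝 u₀, holderNormOn α s (Φ u - Φ u₀) ≤ 1) {K : Set Plane}
    (hK : IsCompact K) :
    ∃ C : ℝ, 0 ≤ C ∧ ∀ u ∈ K, ∀ x ∈ s, ‖Φ u x‖ ≤ C ∧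
      ∀ y ∈ s, ‖Φ u x - Φ u y‖ ≤ C * dist x y ^ (α : ℝ) := by
  have hmono (C C' : ℝ) (u : Plane) (hCC' : C ≤ C') (hu : ∀ x ∈ s, ‖Φ u x‖ ≤ C ∧
      ∀ y ∈ s, ‖Φ u x - Φ u y‖ ≤ C * dist x y ^ (α : ℝ)) : ∀ x ∈ s, ‖Φ u x‖ ≤ C' ∧
      ∀ y ∈ s, ‖Φ u x - Φ u y‖ ≤ C' * dist x y ^ (α : ℝ) := by
    refine fun x hx => ⟨((hu x hx).1).trans hCC', fun y hy => ((hu x hx).2 y hy).trans ?_⟩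
    gcongr
  obtain ⟨C, hC⟩ := exists_uniform_bound_of_isCompact hK hmono fun u =>
    exists_holder_near Φ u (h₀ u) (h u)
  exact ⟨max C 0, le_max_right _ _, fun u hu => hmono _ _ _ (le_max_left _ _) (hC u hu)⟩

end Holder

lemma ContinuousToHolder.exists_bound {α : ℝ≥0} {Φ : Plane → Plane → ℝ}
    (h : ContinuousToHolder α Φ) (R : ℝ) {K : Set Plane} (hK : IsCompact K) :
    ∃ C : ℝ, 0 ≤ C ∧ ∀ u ∈ K, ∀ x ∈ closedBall (0 : Plane) R, |Φ u x| ≤ C ∧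
      ∀ y ∈ closedBall (0 : Plane) R, |Φ u x - Φ u y| ≤ C * dist x y ^ (α : ℝ) :=
  exists_uniform_holder (fun u => h.1 u R)
    (fun u₀ => ((h.2 R u₀).eventually_lt_const one_pos).mono fun _ => le_of_lt) hK

/-- The mean value inequality on the segment from `u` to `v`, where the derivative varies by at most
C|u-v|^γ. Compactness of `K` makes `C` independent of `x`. -/
lemma ContinuousToC1Holder.exists_taylor_bound {γ : ℝ≥0} {Φ : Plane → Plane → ℝ}
    (h : ContinuousToC1Holder γ Φ) (M : ℝ) {K : Set Plane} (hK : IsCompact K) :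
    ∃ C : ℝ, 0 ≤ C ∧ ∀ x ∈ K, ∀ u ∈ closedBall (0 : Plane) M, ∀ v ∈ closedBall (0 : Plane) M,
      |Φ x v - Φ x u - fderiv ℝ (Φ x) u (v - u)| ≤ C * dist u v ^ (1 + γ : ℝ) := by
  have hloc (x₀ : Plane) : ∀ᶠ x in 𝓝 x₀,
      holderNormOn γ (closedBall 0 M) (fderiv ℝ (Φ x) - fderiv ℝ (Φ x₀)) ≤ 1 := by
    refine ((h.2 M x₀).eventually_lt_const one_pos).mono fun x hx => ?_
    have : fderiv ℝ (Φ x - Φ x₀) = fderiv ℝ (Φ x) - fderiv ℝ (Φ x₀) :=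
      funext fun z => fderiv_sub ((h.1 x).1 z) ((h.1 x₀).1 z)
    rw [← this]
    exact le_add_self.trans hx.le
  obtain ⟨C, hC, hΦ⟩ := exists_uniform_holder (Φ := fun x => fderiv ℝ (Φ x)) (α := γ)
    (s := closedBall 0 M) (fun x => le_add_self.trans_lt ((h.1 x).2 M)) hloc hK
  refine ⟨C, hC, fun x hx u hu v hv => ?_⟩
  have hseg : segment ℝ u v ⊆ closedBall 0 M := (convex_closedBall _ _).segment_subset hu hv
  have hbound (z) (hz : z ∈ segment ℝ u v) :
      ‖fderiv ℝ (Φ x) z - fderiv ℝ (Φ x) u‖ ≤ C * dist u v ^ (γ : ℝ) := by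
    refine ((hΦ x hx z (hseg hz)).2 u hu).trans ?_
    gcongr
    have := dist_add_dist_of_mem_segment hz
    rw [dist_comm]
    linarith [dist_nonneg (x := z) (y := v)]
  have := (convex_segment u v).norm_image_sub_le_of_norm_hasFDerivWithin_le'
    (fun z _ => ((h.1 x).1 z).hasFDerivAt.hasFDerivWithinAt) hbound
    (left_mem_segment ℝ u v) (right_mem_segment ℝ u v)
  rw [Real.norm_eq_abs, ← dist_eq_norm, dist_comm v u] at this
  refine this.trans_eq ?_
  rw [add_comm, Real.rpow_add_of_nonneg dist_nonneg γ.coe_nonneg zero_le_one, Real.rpow_one, mul_assoc]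

/-! ### Integrands of the form `F(x, g(x))` -/

lemma rpow_le_const_mul_rpow {d D a b : ℝ} (hd : 0 ≤ d) (hdD : d ≤ D) (ha : 0 ≤ a) (hab : a ≤ b) :
    d ^ b ≤ D ^ (b - a) * d ^ a := by
  rw [← sub_add_cancel b a, Real.rpow_add_of_nonneg hd (sub_nonneg.2 hab) ha, sub_add_cancel]
  have := sub_nonneg.2 hab
  gcongr

lemma norm_le_abs_add_abs (u : Plane) : ‖u‖ ≤ |u 0| + |u 1| := by
  rw [EuclideanSpace.norm_eq, Fin.sum_univ_two, Real.norm_eq_abs, Real.norm_eq_abs,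
    Real.sqrt_le_iff]
  exact ⟨by positivity, by nlinarith [mul_nonneg (abs_nonneg (u 0)) (abs_nonneg (u 1))]⟩

lemma clm_apply_eq (L : Plane →L[ℝ] ℝ) (u : Plane) :
    L u = L (EuclideanSpace.single 0 1) * u 0 + L (EuclideanSpace.single 1 1) * u 1 := by
  have : u = u 0 • EuclideanSpace.single 0 1 + u 1 • EuclideanSpace.single 1 1 := by
    ext i
    fin_cases i <;> simp
  conv_lhs => rw [this]
  simp only [map_add, map_smul, smul_eq_mul]
  ring

/-- The components of `g` are bounded by `C` and Hölder with constant `C` on the ball of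
radius `R`. -/
structure HolderBall (R C β₁ β₂ : ℝ) (g : Plane → Plane) : Prop where
  bound_fst : ∀ p ∈ closedBall (0 : Plane) R, |g p 0| ≤ C
  bound_snd : ∀ p ∈ closedBall (0 : Plane) R, |g p 1| ≤ C
  holder_fst : ∀ p ∈ closedBall (0 : Plane) R, ∀ q ∈ closedBall (0 : Plane) R,
    |g p 0 - g q 0| ≤ C * dist p q ^ β₁
  holder_snd : ∀ p ∈ closedBall (0 : Plane) R, ∀ q ∈ closedBall (0 : Plane) R,
    |g p 1 - g q 1| ≤ C * dist p q ^ β₂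

/-- The exponent of the error in the affine approximation of `F(x, g(x))`. -/
noncomputable def approxExp (α β₁ β₂ γ : ℝ≥0) : ℝ :=
  min (α : ℝ) ((1 + γ) * min (β₁ : ℝ) β₂)

section Integrand

variable {α β₁ β₂ γ : ℝ≥0} {F : Plane → Plane → ℝ}

lemma approxExp_nonneg : 0 ≤ approxExp α β₁ β₂ γ := by
  rw [approxExp]
  positivity

lemma exists_controlled (hF₂ : ContinuousToC1Holder γ (fun u => F u))
    (hF₁ : ContinuousToHolder α (fun u x => F x u)) {R C₀ : ℝ} (hC₀ : 0 ≤ C₀) :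
    ∃ C, 0 ≤ C ∧ ∀ g : Plane → Plane, HolderBall R C₀ β₁ β₂ g →
      Controlled (closedBall 0 R) β₁ β₂ (approxExp α β₁ β₂ γ) C (fun x => F x (g x))
        (fun x => g x 0) (fun x => g x 1) := by
  -- The two coordinates of `g` are bounded by `C₀`, so `g` takes values in the ball of radius `C₀ +
  -- C₀`.
  obtain ⟨K₁, hK₁, h₁⟩ := hF₁.exists_bound R (isCompact_closedBall (0 : Plane) (C₀ + C₀))
  obtain ⟨K₂, hK₂, h₂⟩ := hF₂.exists_taylor_bound (C₀ + C₀) (isCompact_closedBall (0 : Plane) R)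
  set σ := approxExp α β₁ β₂ γ with hσ
  have hσ0 : 0 ≤ σ := approxExp_nonneg
  set β := min (β₁ : ℝ) β₂
  have hβ0 : 0 ≤ β := by positivity
  -- On a bounded set a higher Hölder exponent can be traded for a lower one: `E` is the constant of
  -- `g` for the exponent `β`, while `P` and `Q` reduce the two error exponents to `σ`.
  set E := C₀ * (|R + R| ^ (β₁ - β : ℝ) + |R + R| ^ (β₂ - β : ℝ))
  have hE : 0 ≤ E := by positivity
  set P := |R + R| ^ (α - σ : ℝ)
  set Q := |R + R| ^ ((1 + γ) * β - σ : ℝ)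
  have hP : 0 ≤ P := by positivity
  have hQ : 0 ≤ Q := by positivity
  have hEQ : 0 ≤ K₂ * E ^ (1 + γ : ℝ) * Q := by positivity
  have hKP : 0 ≤ K₁ * P := by positivity
  refine ⟨C₀ + K₁ + K₁ * P + K₂ * E ^ (1 + γ : ℝ) * Q, by positivity, fun g hg => ?_⟩
  have hgB (x) (hx : x ∈ closedBall (0 : Plane) R) : g x ∈ closedBall (0 : Plane) (C₀ + C₀) := by
    rw [mem_closedBall_zero_iff]
    linarith [norm_le_abs_add_abs (g x), hg.bound_fst x hx, hg.bound_snd x hx]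
  refine ⟨fun p hp q hq => (hg.holder_fst p hp q hq).trans ?_,
    fun p hp q hq => (hg.holder_snd p hp q hq).trans ?_,
    fun p hp => ((h₁ _ (hgB p hp) p hp).1).trans ?_, fun p hp => ?_⟩
  · gcongr
    linarith
  · gcongr
    linarith
  · linarith
  -- The approximating affine function is the first-order Taylor polynomial of `F p` at `g p`. The
  -- error is the change of the first variable (order α) plus the Taylor remainder (order (1+γ)β).
  · set L := fderiv ℝ (F p) (g p)
    refine ⟨F p (g p) - L (g p), L (EuclideanSpace.single 0 1), L (EuclideanSpace.single 1 1),
      fun q hq => ?_⟩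
    have hd0 : 0 ≤ dist p q := dist_nonneg
    have hdR : dist p q ≤ |R + R| :=
      ((dist_triangle_right _ _ 0).trans (add_le_add hp hq)).trans (le_abs_self _)
    have hgd : dist (g p) (g q) ≤ E * dist p q ^ β := by
      have e1 := hg.holder_fst p hp q hq
      have e2 := hg.holder_snd p hp q hq
      have e3 := norm_le_abs_add_abs (g p - g q)
      have f1 := mul_le_mul_of_nonneg_left
        (rpow_le_const_mul_rpow hd0 hdR hβ0 (min_le_left (β₁ : ℝ) β₂)) hC₀
      have f2 := mul_le_mul_of_nonneg_left
        (rpow_le_const_mul_rpow hd0 hdR hβ0 (min_le_right (β₁ : ℝ) β₂)) hC₀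
      rw [dist_eq_norm (g p)]
      simp only [PiLp.sub_apply] at e3
      simp only [E, β] at *
      linarith
    have t1 : |F q (g q) - F p (g q)| ≤ K₁ * P * dist p q ^ σ := by
      refine ((h₁ _ (hgB q hq) q hq).2 p hp).trans ?_
      rw [mul_assoc, dist_comm]
      gcongr
      exact rpow_le_const_mul_rpow hd0 hdR hσ0 (min_le_left _ _)
    have t2 : |F p (g q) - F p (g p) - L (g q - g p)| ≤
        K₂ * E ^ (1 + γ : ℝ) * Q * dist p q ^ σ := by
      refine (h₂ p hp _ (hgB p hp) _ (hgB q hq)).trans ?_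
      rw [mul_assoc, mul_assoc]
      gcongr
      calc dist (g p) (g q) ^ (1 + γ : ℝ) ≤ (E * dist p q ^ β) ^ (1 + γ : ℝ) := by gcongr
        _ = E ^ (1 + γ : ℝ) * dist p q ^ ((1 + γ) * β : ℝ) := by
          rw [Real.mul_rpow hE (by positivity), ← Real.rpow_mul hd0, mul_comm β]
        _ ≤ _ := by
          gcongr
          exact rpow_le_const_mul_rpow hd0 hdR hσ0 (min_le_right _ _)
    have hsplit : F q (g q) - (F p (g p) - L (g p) + L (EuclideanSpace.single 0 1) * g q 0 +
        L (EuclideanSpace.single 1 1) * g q 1) =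
        (F q (g q) - F p (g q)) + (F p (g q) - F p (g p) - L (g q - g p)) := by
      rw [map_sub, clm_apply_eq L (g q)]
      ring
    have hpow : 0 ≤ (C₀ + K₁) * dist p q ^ σ := by positivity
    rw [hsplit]
    refine (abs_add_le _ _).trans ((add_le_add t1 t2).trans ?_)
    linarith

lemma continuous_comp (hα : 0 < α) (hF₂ : ContinuousToC1Holder γ (fun u => F u))
    (hF₁ : ContinuousToHolder α (fun u x => F x u)) {g : Plane → Plane} (hg : Continuous g) :
    Continuous fun x => F x (g x) := by
  rw [continuous_iff_continuousAt]
  intro x₀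
  set B := closedBall x₀ 1
  obtain ⟨K, -, hK⟩ := hF₁.exists_bound (‖x₀‖ + 1) ((isCompact_closedBall x₀ 1).image hg)
  have hball : B ⊆ closedBall 0 (‖x₀‖ + 1) := by
    refine closedBall_subset_closedBall' ?_
    rw [dist_zero_right, add_comm]
  have h1 : Tendsto (fun x => F x (g x) - F x₀ (g x)) (𝓝 x₀) (𝓝 0) := by
    refine squeeze_zero_norm' (a := fun x => K * dist x x₀ ^ (α : ℝ)) ?_ ?_
    · filter_upwards [closedBall_mem_nhds x₀ one_pos] with x hx
      exact (hK _ ⟨x, hx, rfl⟩ x (hball hx)).2 x₀ (hball (mem_closedBall_self zero_le_one))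
    · have : Continuous fun x => K * dist x x₀ ^ (α : ℝ) :=
        continuous_const.mul ((continuous_id.dist continuous_const).rpow_const
          fun _ => Or.inr α.coe_nonneg)
      have := this.tendsto x₀
      rwa [dist_self, Real.zero_rpow (by exact_mod_cast hα.ne'), mul_zero] at this
  have h2 : Tendsto (fun x => F x₀ (g x)) (𝓝 x₀) (𝓝 (F x₀ (g x₀))) :=
    ((hF₂.1 x₀).1.continuous.comp hg).tendsto x₀
  rw [ContinuousAt]
  simpa using h1.add h2

end Integrand

lemma HolderBall.continuous {β₁ β₂ : ℝ} (hβ₁ : 0 < β₁) (hβ₂ : 0 < β₂) {c : ℝ → ℝ}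
    {g : Plane → Plane} (hg : ∀ R, HolderBall R (c R) β₁ β₂ g) : Continuous g := by
  have key {β : ℝ} (hβ : 0 < β) {h : Plane → ℝ} (hh : ∀ R, ∀ p ∈ closedBall (0 : Plane) R,
      ∀ q ∈ closedBall (0 : Plane) R, |h p - h q| ≤ c R * dist p q ^ β) : Continuous h := by
    rw [continuous_iff_continuousAt]
    intro x₀
    have hball : closedBall x₀ 1 ⊆ closedBall 0 (‖x₀‖ + 1) := by
      refine closedBall_subset_closedBall' ?_
      rw [dist_zero_right, add_comm]
    rw [ContinuousAt, tendsto_iff_dist_tendsto_zero]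
    refine squeeze_zero' (g := fun x => c (‖x₀‖ + 1) * dist x x₀ ^ β)
      (Eventually.of_forall fun _ => dist_nonneg) ?_ ?_
    · filter_upwards [closedBall_mem_nhds x₀ one_pos] with x hx
      exact hh _ x (hball hx) x₀ (hball (mem_closedBall_self zero_le_one))
    · have : Continuous fun x => c (‖x₀‖ + 1) * dist x x₀ ^ β :=
        continuous_const.mul ((continuous_id.dist continuous_const).rpow_const
          fun _ => Or.inr hβ.le)
      have := this.tendsto x₀
      rwa [dist_self, Real.zero_rpow hβ.ne', mul_zero] at this
  have h0 := key hβ₁ fun R => (hg R).holder_fst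
  have h1 := key hβ₂ fun R => (hg R).holder_snd
  have h : Continuous fun x i => g x i := by
    refine continuous_pi fun i => ?_
    fin_cases i
    · exact h0
    · exact h1
  exact (PiLp.continuous_toLp 2 fun _ : Fin 2 => ℝ).comp h

/-! ### Convergence of the Stratonovich sums -/

lemma continuous_stratSum {f g1 g2 : Plane → ℝ} (hf : Continuous f) (h1 : Continuous g1)
    (h2 : Continuous g2) (n : ℕ) : Continuous (stratSum f g1 g2 n) := by
  rw [stratSum_eq]
  induction n with
  | zero => exact continuous_strat hf h1 h2
  | succ n ih =>
    rw [Function.iterate_succ_apply']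
    exact continuous_dyaGerm ih

lemma alternating_stratSum (f g1 g2 : Plane → ℝ) (n : ℕ) : Alternating (stratSum f g1 g2 n) := by
  rw [stratSum_eq]
  induction n with
  | zero => exact alternating_strat f g1 g2
  | succ n ih =>
    rw [Function.iterate_succ_apply']
    exact alternating_dyaGerm ih

lemma tendsto_stratSum {f g1 g2 : Plane → ℝ} {f' g1' g2' : ℕ → Plane → ℝ}
    (hf : ∀ x, Tendsto (fun k => f' k x) atTop (𝓝 (f x)))
    (h1 : ∀ x, Tendsto (fun k => g1' k x) atTop (𝓝 (g1 x)))
    (h2 : ∀ x, Tendsto (fun k => g2' k x) atTop (𝓝 (g2 x))) (n : ℕ) (S : Simp2) :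
    Tendsto (fun k => stratSum (f' k) (g1' k) (g2' k) n S) atTop (𝓝 (stratSum f g1 g2 n S)) := by
  simp only [stratSum_eq]
  induction n generalizing S with
  | zero =>
    simp only [Function.iterate_zero, id, strat_apply]
    exact (tendsto_const_nhds.mul ((((hf _).add (hf _)).add (hf _)).div_const _)).mul
      ((((h1 _).sub (h1 _)).mul ((h2 _).sub (h2 _))).sub
        (((h1 _).sub (h1 _)).mul ((h2 _).sub (h2 _))))
  | succ n ih =>
    simp only [Function.iterate_succ_apply']
    exact (((ih _).add (ih _)).add (ih _)).add (ih _)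

section Convergence

variable {α β₁ β₂ γ : ℝ≥0} {F : Plane → Plane → ℝ} {c : ℝ → ℝ}

lemma exists_uniform_rate (hβ : 1 < β₁ + β₂) (hαβ : 2 < α + β₁ + β₂)
    (hγβ₁ : 2 < (1 + γ) * β₁ + β₁ + β₂) (hγβ₂ : 2 < (1 + γ) * β₂ + β₁ + β₂)
    (hF₂ : ContinuousToC1Holder γ (fun u => F u))
    (hF₁ : ContinuousToHolder α (fun u x => F x u)) (hc : ∀ R, 0 ≤ c R) (R : ℝ) :
    ∃ A θ : ℝ, 0 ≤ θ ∧ θ < 1 ∧ ∀ g : Plane → Plane, (∀ R, HolderBall R (c R) β₁ β₂ g) →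
      ∀ S : Simp2, (∀ i, S i ∈ closedBall 0 R) → ∀ n,
        dist (stratSum (fun x => F x (g x)) (fun x => g x 0) (fun x => g x 1) n S)
          (stratSum (fun x => F x (g x)) (fun x => g x 0) (fun x => g x 1) (n + 1) S)
            ≤ A * θ ^ n := by
  obtain ⟨C, hC, hctrl⟩ := exists_controlled (β₁ := β₁) (β₂ := β₂) hF₂ hF₁ (R := R) (hc R)
  have hβ' : (1 : ℝ) < β₁ + β₂ := by exact_mod_cast hβ
  have e1 : (2 : ℝ) < α + β₁ + β₂ := by exact_mod_cast hαβ
  have e2 : (2 : ℝ) < (1 + γ) * β₁ + β₁ + β₂ := by exact_mod_cast hγβ₁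
  have e3 : (2 : ℝ) < (1 + γ) * β₂ + β₁ + β₂ := by exact_mod_cast hγβ₂
  -- The possible values of the two minima correspond to the three hypotheses with lower bound 2.
  have hσβ : 2 < approxExp α β₁ β₂ γ + (β₁ + β₂) := by
    rw [approxExp]
    rcases min_choice (α : ℝ) ((1 + γ) * min (β₁ : ℝ) β₂) with h | h <;> rw [h]
    · linarith
    · rcases min_choice (β₁ : ℝ) β₂ with h | h <;> rw [h] <;> linarith
  obtain ⟨A, θ, hθ, hθ', h⟩ := exists_rate β₁.coe_nonneg β₂.coe_nonneg approxExp_nonneg hβ' hσβ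
    hC R
  exact ⟨A, θ, hθ, hθ', fun g hg => h _ _ _ (hctrl g (hg R))⟩

lemma mem_closedBall_norm (S : Simp2) (i : Fin 3) : S i ∈ closedBall (0 : Plane) ‖S‖ := by
  rw [mem_closedBall_zero_iff]
  exact norm_le_pi_norm S i

lemma tendsto_stratIntegral (hβ : 1 < β₁ + β₂) (hαβ : 2 < α + β₁ + β₂)
    (hγβ₁ : 2 < (1 + γ) * β₁ + β₁ + β₂) (hγβ₂ : 2 < (1 + γ) * β₂ + β₁ + β₂)
    (hF₂ : ContinuousToC1Holder γ (fun u => F u))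
    (hF₁ : ContinuousToHolder α (fun u x => F x u)) (hc : ∀ R, 0 ≤ c R) {g : Plane → Plane}
    (hg : ∀ R, HolderBall R (c R) β₁ β₂ g) (S : Simp2) :
    Tendsto (fun n => stratSum (fun x => F x (g x)) (fun x => g x 0) (fun x => g x 1) n S)
      atTop (𝓝 (stratIntegral F g S)) := by
  obtain ⟨A, θ, -, hθ, h⟩ := exists_uniform_rate hβ hαβ hγβ₁ hγβ₂ hF₂ hF₁ hc ‖S‖
  exact tendsto_nhds_limUnder (cauchySeq_tendsto_of_complete
    (cauchySeq_of_le_geometric θ A hθ (h g hg S (mem_closedBall_norm S))))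

/-- The Stratonovich sums converge uniformly over bounded sets of simplices and over sets of
functions `g` with bounded Hölder norms. -/
lemma exists_dist_stratSum_lt (hβ : 1 < β₁ + β₂) (hαβ : 2 < α + β₁ + β₂)
    (hγβ₁ : 2 < (1 + γ) * β₁ + β₁ + β₂) (hγβ₂ : 2 < (1 + γ) * β₂ + β₁ + β₂)
    (hF₂ : ContinuousToC1Holder γ (fun u => F u))
    (hF₁ : ContinuousToHolder α (fun u x => F x u)) (hc : ∀ R, 0 ≤ c R) (R : ℝ) {ε : ℝ}
    (hε : 0 < ε) :
    ∃ N, ∀ g : Plane → Plane, (∀ R, HolderBall R (c R) β₁ β₂ g) →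
      ∀ S : Simp2, (∀ i, S i ∈ closedBall 0 R) →
        dist (stratSum (fun x => F x (g x)) (fun x => g x 0) (fun x => g x 1) N S)
          (stratIntegral F g S) < ε := by
  obtain ⟨A, θ, hθ, hθ', h⟩ := exists_uniform_rate hβ hαβ hγβ₁ hγβ₂ hF₂ hF₁ hc R
  have hlim : Tendsto (fun n => A * θ ^ n / (1 - θ)) atTop (𝓝 0) := by
    simpa using ((tendsto_pow_atTop_nhds_zero_of_lt_one hθ hθ').const_mul A).div_const (1 - θ)
  obtain ⟨N, hN⟩ := (hlim.eventually_lt_const hε).exists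
  exact ⟨N, fun g hg S hS => (dist_le_of_le_geometric_of_tendsto θ A hθ' (h g hg S hS)
    (tendsto_stratIntegral hβ hαβ hγβ₁ hγβ₂ hF₂ hF₁ hc hg S) N).trans_lt hN⟩

lemma continuous_stratIntegral (hα : 0 < α) (hβ₁ : 0 < β₁) (hβ₂ : 0 < β₂) (hβ : 1 < β₁ + β₂)
    (hαβ : 2 < α + β₁ + β₂)
    (hγβ₁ : 2 < (1 + γ) * β₁ + β₁ + β₂) (hγβ₂ : 2 < (1 + γ) * β₂ + β₁ + β₂)
    (hF₂ : ContinuousToC1Holder γ (fun u => F u))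
    (hF₁ : ContinuousToHolder α (fun u x => F x u)) (hc : ∀ R, 0 ≤ c R) {g : Plane → Plane}
    (hg : ∀ R, HolderBall R (c R) β₁ β₂ g) : Continuous (stratIntegral F g) := by
  have hgc := HolderBall.continuous (NNReal.coe_pos.2 hβ₁) (NNReal.coe_pos.2 hβ₂) hg
  refine continuous_of_locally_uniform_approx_of_continuousAt fun S u hu => ?_
  obtain ⟨ε, hε, hu⟩ := Metric.mem_uniformity_dist.1 hu
  obtain ⟨N, hN⟩ := exists_dist_stratSum_lt hβ hαβ hγβ₁ hγβ₂ hF₂ hF₁ hc (‖S‖ + 1) hε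
  have hsum := continuous_stratSum (continuous_comp hα hF₂ hF₁ hgc)
    (by fun_prop : Continuous fun x => g x 0) (by fun_prop : Continuous fun x => g x 1) N
  refine ⟨closedBall S 1, closedBall_mem_nhds S one_pos, _, hsum.continuousAt, fun T hT => hu ?_⟩
  rw [dist_comm]
  exact hN g hg T fun i =>
    closedBall_subset_closedBall (norm_le_of_mem_closedBall hT) (mem_closedBall_norm T i)

lemma alternating_stratIntegral (hβ : 1 < β₁ + β₂) (hαβ : 2 < α + β₁ + β₂)
    (hγβ₁ : 2 < (1 + γ) * β₁ + β₁ + β₂) (hγβ₂ : 2 < (1 + γ) * β₂ + β₁ + β₂)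
    (hF₂ : ContinuousToC1Holder γ (fun u => F u))
    (hF₁ : ContinuousToHolder α (fun u x => F x u)) (hc : ∀ R, 0 ≤ c R) {g : Plane → Plane}
    (hg : ∀ R, HolderBall R (c R) β₁ β₂ g) : Alternating (stratIntegral F g) := by
  intro τ S
  have h := tendsto_stratIntegral hβ hαβ hγβ₁ hγβ₂ hF₂ hF₁ hc hg
  refine tendsto_nhds_unique (h _) (((h S).const_mul _).congr fun n => ?_)
  exact (alternating_stratSum _ _ _ n τ S).symm

/-- Interchange of limits: one `N` serves all `G k` and `g`, and the `N`-th sum involves `g` at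
finitely many points only, so pointwise convergence suffices. -/
lemma tendsto_stratIntegral_of_tendsto (hβ : 1 < β₁ + β₂) (hαβ : 2 < α + β₁ + β₂)
    (hγβ₁ : 2 < (1 + γ) * β₁ + β₁ + β₂) (hγβ₂ : 2 < (1 + γ) * β₂ + β₁ + β₂)
    (hF₂ : ContinuousToC1Holder γ (fun u => F u))
    (hF₁ : ContinuousToHolder α (fun u x => F x u)) (hc : ∀ R, 0 ≤ c R) {g : Plane → Plane}
    (hg : ∀ R, HolderBall R (c R) β₁ β₂ g) {G : ℕ → Plane → Plane}
    (hG : ∀ k R, HolderBall R (c R) β₁ β₂ (G k))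
    (hlim : ∀ x, Tendsto (fun k => G k x) atTop (𝓝 (g x))) (S : Simp2) :
    Tendsto (fun k => stratIntegral F (G k) S) atTop (𝓝 (stratIntegral F g S)) := by
  rw [Metric.tendsto_nhds]
  intro ε hε
  obtain ⟨N, hN⟩ := exists_dist_stratSum_lt hβ hαβ hγβ₁ hγβ₂ hF₂ hF₁ hc ‖S‖
    (by positivity : 0 < ε / 3)
  have hcoord (i : Fin 2) (x) : Tendsto (fun k => G k x i) atTop (𝓝 (g x i)) :=
    ((by fun_prop : Continuous fun u : Plane => u i).tendsto _).comp (hlim x)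
  have hsum := tendsto_stratSum (f := fun x => F x (g x)) (f' := fun k x => F x (G k x))
    (fun x => ((hF₂.1 x).1.continuous.tendsto _).comp (hlim x)) (hcoord 0) (hcoord 1) N S
  filter_upwards [Metric.tendsto_nhds.1 hsum (ε / 3) (by positivity)] with k hk
  have e1 := hN g hg S (mem_closedBall_norm S)
  have e2 := hN (G k) (hG k) S (mem_closedBall_norm S)
  rw [dist_comm] at e2
  have := dist_triangle4 (stratIntegral F (G k) S)
    (stratSum (fun x => F x (G k x)) (fun x => G k x 0) (fun x => G k x 1) N S)
    (stratSum (fun x => F x (g x)) (fun x => g x 0) (fun x => g x 1) N S) (stratIntegral F g S)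
  linarith

end Convergence

/-! ### Flat simplices -/

/-- Three non-collinear points affinely span the plane, so their convex hull has interior points and
hence positive area. -/
lemma collinear_of_volume_convexHull_eq_zero {S : Simp2}
    (h : volume (convexHull ℝ (Set.range S)) = 0) : Collinear ℝ (Set.range S) := by
  by_contra hcol
  have hS : Set.range S = {S 0, S 1, S 2} := by
    ext x
    simp only [Set.mem_range, Fin.exists_fin_succ, Set.mem_insert_iff, Set.mem_singleton_iff]
    simp [eq_comm]
  have hind : AffineIndependent ℝ S := by
    rw [hS, ← affineIndependent_iff_not_collinear_set, ← eq_vec] at hcol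
    exact hcol
  have htop : affineSpan ℝ (Set.range S) = ⊤ := by
    rw [hind.affineSpan_eq_top_iff_card_eq_finrank_add_one]
    simp
  have hint := interior_convexHull_nonempty_iff_affineSpan_eq_top.2 htop
  exact (Measure.measure_pos_of_nonempty_interior volume hint).ne' h

/-- A flat simplex is carried by a line parametrized by arclength. -/
lemma exists_eq_add_smul_of_collinear {S : Simp2} (h : Collinear ℝ (Set.range S)) :
    ∃ (p v : Plane) (r : Fin 3 → ℝ), ‖v‖ = 1 ∧ ∀ i, S i = p + r i • v := by
  obtain ⟨p, v, hv⟩ := (collinear_iff_exists_forall_eq_smul_vadd (k := ℝ) _).1 h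
  choose r hr using fun i => hv (S i) ⟨i, rfl⟩
  rcases eq_or_ne v 0 with rfl | hv0
  -- All vertices coincide, and any unit direction will do.
  · refine ⟨p, EuclideanSpace.single 0 1, 0, by simp, fun i => ?_⟩
    simp [hr i]
  · refine ⟨p, ‖v‖⁻¹ • v, fun i => r i * ‖v‖, norm_smul_inv_norm hv0, fun i => ?_⟩
    rw [hr i, vadd_eq_add, add_comm, smul_smul, mul_assoc, mul_inv_cancel₀ (norm_ne_zero_iff.2 hv0),
      mul_one]

/-- `h` is `C^{1,β}` on `[-T, T]`, with constant `K`. -/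
def C1Bound (T β K : ℝ) (h : ℝ → ℝ) : Prop :=
  ∃ ψ : ℝ → ℝ, ∀ a ∈ Set.Icc (-T) T, ∀ b ∈ Set.Icc (-T) T,
    |h b - h a - ψ a * (b - a)| ≤ K * |b - a| ^ (1 + β) ∧ |ψ a| ≤ K ∧ |h b - h a| ≤ K * |b - a|

/-- The segment `{p + t v : |t| ≤ T}`. -/
def lineSegment (p v : Plane) (T : ℝ) : Set Plane := (fun t : ℝ => p + t • v) '' Set.Icc (-T) T

lemma convex_lineSegment (p v : Plane) (T : ℝ) : Convex ℝ (lineSegment p v T) := by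
  have := (convex_Icc (-T) T).affine_image
    (AffineMap.const ℝ ℝ p + (LinearMap.toSpanSingleton ℝ Plane v).toAffineMap)
  exact this

lemma isCompact_lineSegment (p v : Plane) (T : ℝ) : IsCompact (lineSegment p v T) :=
  isCompact_Icc.image (by fun_prop)

/-- On a line along which `g` is `C^{1,β}`, the Stratonovich germ is of order `2 + β`. -/
lemma germBound_strat_lineSegment {p v : Plane} (hv : ‖v‖ = 1) {T β K : ℝ} (hβ : 0 ≤ β)
    (hK : 0 ≤ K) {f g1 g2 : Plane → ℝ} (hf : ∀ x ∈ lineSegment p v T, |f x| ≤ K)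
    (h1 : C1Bound T β K fun t => g1 (p + t • v)) (h2 : C1Bound T β K fun t => g2 (p + t • v)) :
    GermBound (lineSegment p v T) (2 + β) (2 * K ^ 3) (strat f g1 g2) := by
  intro S D hS hD
  have hD0 : 0 ≤ D := dist_nonneg.trans (hD 0 0)
  choose t ht hSt using hS
  obtain ⟨ψ1, h1⟩ := h1
  obtain ⟨ψ2, h2⟩ := h2
  have htD (i j) : |t i - t j| ≤ D := by
    have := hD i j
    rw [← hSt, ← hSt] at this
    simpa [dist_eq_norm, ← sub_smul, norm_smul, hv] using this
  have hpow (i j) : K * |t i - t j| ^ (1 + β) ≤ K * (D * D ^ β) := by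
    have e : D * D ^ β = D ^ (1 + β) := by
      rw [Real.rpow_add_of_nonneg hD0 zero_le_one hβ, Real.rpow_one]
    rw [e]
    have := htD i j
    gcongr
  have hlin (i j) : K * |t i - t j| ≤ K * D := mul_le_mul_of_nonneg_left (htD i j) hK
  have a1 := h1 (t 0) (ht 0) (t 1) (ht 1)
  have a2 := h1 (t 0) (ht 0) (t 2) (ht 2)
  have b1 := h2 (t 0) (ht 0) (t 1) (ht 1)
  have b2 := h2 (t 0) (ht 0) (t 2) (ht 2)
  simp only [hSt] at a1 a2 b1 b2
  set x1 := t 1 - t 0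
  set x2 := t 2 - t 0
  set E := K * (D * D ^ β)
  have hE : 0 ≤ E := by positivity
  have hx1 : |x1| ≤ D := htD 1 0
  have hx2 : |x2| ≤ D := htD 2 0
  have hav : |(f (S 0) + f (S 1) + f (S 2)) / 3| ≤ K := by
    have hfS (i) : |f (S i)| ≤ K := hf _ ⟨t i, ht i, hSt i⟩
    rw [abs_div, abs_of_pos (by norm_num : (0 : ℝ) < 3), div_le_iff₀ (by norm_num)]
    linarith [abs_add_three (f (S 0)) (f (S 1)) (f (S 2)), hfS 0, hfS 1, hfS 2]
  have hdet : |(g1 (S 1) - g1 (S 0)) * (g2 (S 2) - g2 (S 0)) -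
      (g1 (S 2) - g1 (S 0)) * (g2 (S 1) - g2 (S 0))| ≤ 4 * (K * D * E) := by
    -- The products of linear parts ψ1 ψ2 x1 x2 cancel in the determinant, so every remaining term
    -- contains a first-order Taylor remainder.
    have hsplit : (g1 (S 1) - g1 (S 0)) * (g2 (S 2) - g2 (S 0)) -
        (g1 (S 2) - g1 (S 0)) * (g2 (S 1) - g2 (S 0)) =
        ψ1 (t 0) * x1 * (g2 (S 2) - g2 (S 0) - ψ2 (t 0) * x2)
        - ψ1 (t 0) * x2 * (g2 (S 1) - g2 (S 0) - ψ2 (t 0) * x1)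
        + ((g2 (S 2) - g2 (S 0)) * (g1 (S 1) - g1 (S 0) - ψ1 (t 0) * x1)
        - (g2 (S 1) - g2 (S 0)) * (g1 (S 2) - g1 (S 0) - ψ1 (t 0) * x2)) := by ring
    have hKD : 0 ≤ K * D := by positivity
    have key {a b : ℝ} (ha : |a| ≤ K * D) (hb : |b| ≤ E) : |a * b| ≤ K * D * E := by
      rw [abs_mul]
      exact mul_le_mul ha hb (abs_nonneg _) hKD
    have hψ {x : ℝ} (hx : |x| ≤ D) : |ψ1 (t 0) * x| ≤ K * D := by
      rw [abs_mul]
      exact mul_le_mul a1.2.1 hx (abs_nonneg _) hK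
    have c1 := key (hψ hx1) (b2.1.trans (hpow 2 0))
    have c2 := key (hψ hx2) (b1.1.trans (hpow 1 0))
    have c3 := key (b2.2.2.trans (hlin 2 0)) (a1.1.trans (hpow 1 0))
    have c4 := key (b1.2.2.trans (hlin 1 0)) (a2.1.trans (hpow 2 0))
    rw [hsplit]
    refine (abs_add_le _ _).trans ((add_le_add (abs_sub _ _) (abs_sub _ _)).trans ?_)
    linarith
  have hfin := mul_le_mul hav hdet (abs_nonneg _) hK
  rw [strat_apply, abs_mul, abs_mul, abs_of_pos (by norm_num : (0 : ℝ) < 1 / 2),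
    Real.rpow_add_of_nonneg hD0 zero_le_two hβ, Real.rpow_two]
  calc _ = 1 / 2 * (|(f (S 0) + f (S 1) + f (S 2)) / 3| *
        |(g1 (S 1) - g1 (S 0)) * (g2 (S 2) - g2 (S 0)) -
          (g1 (S 2) - g1 (S 0)) * (g2 (S 1) - g2 (S 0))|) := by ring
    _ ≤ 1 / 2 * (K * (4 * (K * D * E))) := by gcongr
    _ = _ := by
      simp only [E]
      ring

/-- After n subdivisions there are 4^n pieces of size 2^(-nκ), and κ > 2. -/
lemma tendsto_stratSum_zero_of_germBound {s : Set Plane} (hs : Convex ℝ s) {κ C : ℝ} (hκ : 2 < κ)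
    {f g1 g2 : Plane → ℝ} (h : GermBound s κ C (strat f g1 g2)) {S : Simp2} (hS : ∀ i, S i ∈ s) :
    Tendsto (fun n => stratSum f g1 g2 n S) atTop (𝓝 0) := by
  have hθ : (4 / 2 ^ κ : ℝ) < 1 := by
    rw [div_lt_one (by positivity)]
    calc (4 : ℝ) = 2 ^ (2 : ℝ) := by norm_num
      _ < _ := Real.rpow_lt_rpow_of_exponent_lt one_lt_two hκ
  obtain ⟨D, hD⟩ : ∃ D, ∀ i j, dist (S i) (S j) ≤ D :=
    ⟨‖S‖ + ‖S‖, fun i j => (dist_le_norm_add_norm _ _).trans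
      (add_le_add (norm_le_pi_norm S i) (norm_le_pi_norm S j))⟩
  refine squeeze_zero_norm (a := fun n => (4 / 2 ^ κ) ^ n * C * D ^ κ) (fun n => ?_) ?_
  · rw [stratSum_eq]
    exact (h.dyaGerm_iterate hs n) S D hS hD
  · simpa using ((tendsto_pow_atTop_nhds_zero_of_lt_one (by positivity) hθ).mul_const C).mul_const
      (D ^ κ)

/-! ### Averaging along a line -/

/-- The moving average of a Hölder function is `C^{1,β}`. -/
lemma exists_c1Bound_average {h : ℝ → ℝ} (hc : Continuous h) {δ T β K : ℝ} (hδ : 0 < δ)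
    (hβ : 0 ≤ β) (hK : 0 ≤ K) (hK' : ∀ a ∈ Set.Icc (-(T + δ)) (T + δ),
      ∀ b ∈ Set.Icc (-(T + δ)) (T + δ), |h b - h a| ≤ K * |b - a| ^ β) :
    ∃ K', ∀ K'' ≥ K', C1Bound T β K'' fun t => ∫ s in (0 : ℝ)..1, h (t + s * δ) := by
  set ψ : ℝ → ℝ := fun t => δ⁻¹ * (h (t + δ) - h t) with hψ
  have hψc : Continuous ψ := by fun_prop
  have hint (t : ℝ) : ∫ s in (0 : ℝ)..1, h (t + s * δ) =
      -- A difference quotient of the primitive of `h`; its derivative `ψ` is a difference quotient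
      -- of `h`, hence as Hölder as `h`.
      δ⁻¹ * ((∫ s in (0 : ℝ)..(t + δ), h s) - ∫ s in (0 : ℝ)..t, h s) := by
    rw [intervalIntegral.integral_interval_sub_left (hc.intervalIntegrable _ _)
      (hc.intervalIntegrable _ _)]
    have := intervalIntegral.integral_comp_add_mul h (a := 0) (b := 1) hδ.ne' t
    simp only [mul_zero, add_zero, mul_one, smul_eq_mul] at this
    rw [← this]
    simp only [mul_comm]
  have hder (t : ℝ) : HasDerivAt (fun t => ∫ s in (0 : ℝ)..1, h (t + s * δ)) (ψ t) t := by
    simp only [hint]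
    have e (t : ℝ) : HasDerivAt (fun t => ∫ s in (0 : ℝ)..t, h s) (h t) t :=
      hc.integral_hasStrictDerivAt 0 t |>.hasDerivAt
    exact (((e (t + δ)).comp_add_const t δ).sub (e t)).const_mul δ⁻¹
  obtain ⟨B, hB⟩ := isCompact_Icc.exists_bound_of_continuousOn (s := Set.Icc (-T) T)
    hψc.continuousOn
  have hψH (a) (ha : a ∈ Set.Icc (-T) T) (b) (hb : b ∈ Set.Icc (-T) T) :
      |ψ b - ψ a| ≤ δ⁻¹ * (2 * K) * |b - a| ^ β := by
    have e1 := hK' a ⟨by linarith [ha.1], by linarith [ha.2]⟩ b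
      ⟨by linarith [hb.1], by linarith [hb.2]⟩
    have e2 := hK' (a + δ) ⟨by linarith [ha.1], by linarith [ha.2]⟩ (b + δ)
      ⟨by linarith [hb.1], by linarith [hb.2]⟩
    rw [add_sub_add_right_eq_sub] at e2
    have e3 : ψ b - ψ a = δ⁻¹ * ((h (b + δ) - h (a + δ)) - (h b - h a)) := by
      simp only [hψ]
      ring
    rw [e3, abs_mul, abs_of_pos (inv_pos.2 hδ), mul_assoc]
    refine mul_le_mul_of_nonneg_left ?_ (inv_pos.2 hδ).le
    linarith [abs_sub (h (b + δ) - h (a + δ)) (h b - h a)]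
  refine ⟨max B (δ⁻¹ * (2 * K)), fun K'' hK'' => ⟨ψ, fun a ha b hb => ⟨?_, ?_, ?_⟩⟩⟩
  -- The mean value inequality for the average minus its linear part at `a`, whose derivative is `ψ
  -- t - ψ a`.
  · have hsub : Set.uIcc a b ⊆ Set.Icc (-T) T := Set.uIcc_subset_Icc ha hb
    have := (convex_uIcc a b).norm_image_sub_le_of_norm_hasDerivWithin_le
      (f := fun t => (∫ s in (0 : ℝ)..1, h (t + s * δ)) - ψ a * t) (f' := fun t => ψ t - ψ a)
      (C := δ⁻¹ * (2 * K) * |b - a| ^ β)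
      (fun t _ => by
        simpa using ((hder t).fun_sub ((hasDerivAt_id t).const_mul (ψ a))).hasDerivWithinAt)
      (fun t ht => (hψH a ha t (hsub ht)).trans (by
        have := Set.abs_sub_left_of_mem_uIcc ht
        gcongr))
      Set.left_mem_uIcc Set.right_mem_uIcc
    simp only [Real.norm_eq_abs] at this
    rw [Real.rpow_add_of_nonneg (abs_nonneg _) zero_le_one hβ, Real.rpow_one]
    calc _ = |(∫ s in (0 : ℝ)..1, h (b + s * δ)) - ψ a * b -
          ((∫ s in (0 : ℝ)..1, h (a + s * δ)) - ψ a * a)| := by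
          congr 1
          ring
      _ ≤ _ := this
      _ = δ⁻¹ * (2 * K) * (|b - a| * |b - a| ^ β) := by ring
      _ ≤ _ := by
        gcongr
        exact (le_max_right _ _).trans hK''
  · exact (hB a ha).trans ((le_max_left _ _).trans hK'')
  · have hsub : Set.uIcc a b ⊆ Set.Icc (-T) T := Set.uIcc_subset_Icc ha hb
    have := (convex_uIcc a b).norm_image_sub_le_of_norm_hasDerivWithin_le
      (fun t _ => (hder t).hasDerivWithinAt)
      (fun t ht => (hB t (hsub ht)).trans ((le_max_left _ _).trans hK''))
      Set.left_mem_uIcc Set.right_mem_uIcc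
    simpa only [Real.norm_eq_abs] using this

/-- The moving average of `g` over segments of direction `v` and relative length `δ`. -/
noncomputable def lineAverage (g : Plane → Plane) (v : Plane) (δ : ℝ) : Plane → Plane := fun x =>
  WithLp.toLp 2 fun i => ∫ s in (0 : ℝ)..1, g (x + (s * δ) • v) i

section Average

variable {β₁ β₂ : ℝ} {c : ℝ → ℝ} {g : Plane → Plane} {v : Plane} {δ : ℝ}

lemma add_smul_mem_closedBall (hv : ‖v‖ = 1) (hδ : 0 ≤ δ) (hδ1 : δ ≤ 1) {R : ℝ} {x : Plane}
    (hx : x ∈ closedBall (0 : Plane) R) {s : ℝ} (hs : s ∈ Set.uIoc 0 1) :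
    x + (s * δ) • v ∈ closedBall (0 : Plane) (R + 1) := by
  rw [Set.uIoc_of_le zero_le_one] at hs
  rw [mem_closedBall_zero_iff] at hx ⊢
  refine (norm_add_le _ _).trans (add_le_add hx ?_)
  rw [norm_smul, hv, mul_one, Real.norm_of_nonneg (mul_nonneg hs.1.le hδ)]
  exact mul_le_one₀ hs.2 hδ hδ1

/-- An average of translates inherits bounds and Hölder constants. The translations have length at
most 1, hence the constant of the ball of radius `R + 1`, independent of `δ`. -/
lemma holderBall_lineAverage (hg : ∀ R, HolderBall R (c R) β₁ β₂ g) (hgc : Continuous g)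
    (hv : ‖v‖ = 1) (hδ : 0 ≤ δ) (hδ1 : δ ≤ 1) (R : ℝ) :
    HolderBall R (c (R + 1)) β₁ β₂ (lineAverage g v δ) := by
  have hbound {h : Plane → ℝ} {C : ℝ} (hh : ∀ x ∈ closedBall (0 : Plane) (R + 1), |h x| ≤ C) (x)
      (hx : x ∈ closedBall (0 : Plane) R) : |∫ s in (0 : ℝ)..1, h (x + (s * δ) • v)| ≤ C := by
    have := intervalIntegral.norm_integral_le_of_norm_le_const (a := 0) (b := 1)
      (f := fun s => h (x + (s * δ) • v)) (C := C) fun s hs => hh _ (add_smul_mem_closedBall hv hδ hδ1 hx hs)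
    simpa using this
  have hholder {h : Plane → ℝ} {C β : ℝ} (hc : Continuous h)
      (hh : ∀ x ∈ closedBall (0 : Plane) (R + 1), ∀ y ∈ closedBall (0 : Plane) (R + 1),
        |h x - h y| ≤ C * dist x y ^ β) (x) (hx : x ∈ closedBall (0 : Plane) R) (y)
      (hy : y ∈ closedBall (0 : Plane) R) :
      |(∫ s in (0 : ℝ)..1, h (x + (s * δ) • v)) - ∫ s in (0 : ℝ)..1, h (y + (s * δ) • v)|
        ≤ C * dist x y ^ β := by
    have hi (z : Plane) :
        IntervalIntegrable (fun s : ℝ => h (z + (s * δ) • v)) volume 0 1 :=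
      Continuous.intervalIntegrable (by fun_prop) _ _
    rw [← intervalIntegral.integral_sub (hi x) (hi y)]
    have := intervalIntegral.norm_integral_le_of_norm_le_const (a := 0) (b := 1)
      (f := fun s => h (x + (s * δ) • v) - h (y + (s * δ) • v)) (C := C * dist x y ^ β)
      fun s hs => (hh _ (add_smul_mem_closedBall hv hδ hδ1 hx hs) _
        (add_smul_mem_closedBall hv hδ hδ1 hy hs)).trans_eq (by rw [dist_add_right])
    simpa using this
  exact ⟨hbound (hg (R + 1)).bound_fst, hbound (hg (R + 1)).bound_snd,
    hholder (h := fun x => g x 0) (by fun_prop) (hg (R + 1)).holder_fst,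
    hholder (h := fun x => g x 1) (by fun_prop) (hg (R + 1)).holder_snd⟩

/-- The average depends continuously on `δ`, and at `δ = 0` it equals `g`. -/
lemma tendsto_lineAverage (hgc : Continuous g) (v x : Plane) :
    Tendsto (fun k : ℕ => lineAverage g v (1 / ((k : ℝ) + 1)) x) atTop (𝓝 (g x)) := by
  have hcont : Continuous fun δ : ℝ => lineAverage g v δ x := by
    refine (PiLp.continuous_toLp 2 fun _ : Fin 2 => ℝ).comp (continuous_pi fun i => ?_)
    refine intervalIntegral.continuous_parametric_intervalIntegral_of_continuous' ?_ _ _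
    simp only [Function.uncurry_def]
    fun_prop
  have h0 : lineAverage g v 0 x = g x := by
    ext i
    simp [lineAverage]
  rw [← h0]
  exact (hcont.tendsto 0).comp tendsto_one_div_add_atTop_nhds_zero_nat

/-- Both components are brought to the common exponent `min β₁ β₂`. The form with every larger
constant allows one constant to serve both components and the integrand. It may blow up as `δ` tends
to 0. -/
lemma exists_c1Bound_lineAverage (hβ₁ : 0 ≤ β₁) (hβ₂ : 0 ≤ β₂) (hc : ∀ R, 0 ≤ c R)
    (hg : ∀ R, HolderBall R (c R) β₁ β₂ g) (hgc : Continuous g) (hv : ‖v‖ = 1) (hδ : 0 < δ)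
    (p : Plane) (T : ℝ) (i : Fin 2) :
    ∃ K', ∀ K'' ≥ K', C1Bound T (min β₁ β₂) K'' fun t => lineAverage g v δ (p + t • v) i := by
  set R := ‖p‖ + (T + δ)
  have hmem (t) (ht : t ∈ Set.Icc (-(T + δ)) (T + δ)) :
      p + t • v ∈ closedBall (0 : Plane) R := by
    rw [mem_closedBall_zero_iff]
    refine (norm_add_le _ _).trans ?_
    rw [norm_smul, hv, mul_one, Real.norm_eq_abs]
    exact add_le_add_right (abs_le.2 ht) _
  have hdist (a b : ℝ) : dist (p + b • v) (p + a • v) = |b - a| := by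
    rw [dist_add_left, dist_eq_norm, ← sub_smul, norm_smul, hv, mul_one, Real.norm_eq_abs]
  have hmin : 0 ≤ min β₁ β₂ := le_min hβ₁ hβ₂
  have hrough {h : Plane → ℝ} {β : ℝ} (hβ : min β₁ β₂ ≤ β) (hcont : Continuous h)
      (hh : ∀ x ∈ closedBall (0 : Plane) R, ∀ y ∈ closedBall (0 : Plane) R,
        |h x - h y| ≤ c R * dist x y ^ β) :
      ∃ K', ∀ K'' ≥ K', C1Bound T (min β₁ β₂) K'' fun t =>
        ∫ s in (0 : ℝ)..1, h (p + t • v + (s * δ) • v) := by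
    obtain ⟨K', hK'⟩ := exists_c1Bound_average (h := fun t => h (p + t • v)) (T := T)
      (β := min β₁ β₂) (K := c R * |(T + δ) + (T + δ)| ^ (β - min β₁ β₂)) (by fun_prop) hδ hmin
      (mul_nonneg (hc R) (by positivity)) fun a ha b hb => by
        refine (hh _ (hmem b hb) _ (hmem a ha)).trans ?_
        rw [hdist, mul_assoc]
        refine mul_le_mul_of_nonneg_left
          (rpow_le_const_mul_rpow (abs_nonneg _) ?_ hmin hβ) (hc R)
        refine le_trans (abs_le.2 ⟨?_, ?_⟩) (le_abs_self _)
        · linarith [hb.1, ha.2]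
        · linarith [hb.2, ha.1]
    refine ⟨K', fun K'' hK'' => ?_⟩
    simpa only [add_smul, ← add_assoc] using hK' K'' hK''
  fin_cases i
  · exact hrough (h := fun x => g x 0) (min_le_left _ _) (by fun_prop) (hg R).holder_fst
  · exact hrough (h := fun x => g x 1) (min_le_right _ _) (by fun_prop) (hg R).holder_snd

end Average

/-! ### Vanishing of the integral on flat simplices -/

section Nonatomic

variable {α β₁ β₂ γ : ℝ≥0} {F : Plane → Plane → ℝ} {c : ℝ → ℝ}

lemma nonatomic_stratIntegral (hα : 0 < α) (hβ₁ : 0 < β₁) (hβ₂ : 0 < β₂) (hβ : 1 < β₁ + β₂)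
    (hαβ : 2 < α + β₁ + β₂)
    (hγβ₁ : 2 < (1 + γ) * β₁ + β₁ + β₂) (hγβ₂ : 2 < (1 + γ) * β₂ + β₁ + β₂)
    (hF₂ : ContinuousToC1Holder γ (fun u => F u))
    (hF₁ : ContinuousToHolder α (fun u x => F x u)) (hc : ∀ R, 0 ≤ c R) {g : Plane → Plane}
    (hg : ∀ R, HolderBall R (c R) β₁ β₂ g) : Nonatomic (stratIntegral F g) := by
  intro S hS
  obtain ⟨p, v, r, hv, hr⟩ :=
    exists_eq_add_smul_of_collinear (collinear_of_volume_convexHull_eq_zero hS)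
  have hβ₁' : (0 : ℝ) < β₁ := by exact_mod_cast hβ₁
  have hβ₂' : (0 : ℝ) < β₂ := by exact_mod_cast hβ₂
  have hgc := HolderBall.continuous hβ₁' hβ₂' hg
  -- One family of constants valid for `g` and for all its averages, as continuity in `g` requires.
  set d : ℝ → ℝ := fun R => max (c R) (c (R + 1))
  have hd (R) : 0 ≤ d R := le_max_of_le_left (hc R)
  have hmono {R C C' : ℝ} {u : Plane → Plane} (hCC' : C ≤ C') (hu : HolderBall R C β₁ β₂ u) :
      HolderBall R C' β₁ β₂ u :=
    ⟨fun x hx => (hu.bound_fst x hx).trans hCC', fun x hx => (hu.bound_snd x hx).trans hCC',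
      fun x hx y hy => (hu.holder_fst x hx y hy).trans (by gcongr),
      fun x hx y hy => (hu.holder_snd x hx y hy).trans (by gcongr)⟩
  have hgd (R) : HolderBall R (d R) β₁ β₂ g := hmono (le_max_left _ _) (hg R)
  set G : ℕ → Plane → Plane := fun k => lineAverage g v (1 / ((k : ℝ) + 1))
  have hδ0 (k : ℕ) : 0 < 1 / ((k : ℝ) + 1) := by positivity
  have hδ1 (k : ℕ) : 1 / ((k : ℝ) + 1) ≤ 1 := by
    rw [div_le_one (by positivity)]
    linarith [k.cast_nonneg (α := ℝ)]
  have hG (k R) : HolderBall R (d R) β₁ β₂ (G k) :=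
    hmono (le_max_right _ _) (holderBall_lineAverage hg hgc hv (hδ0 k).le (hδ1 k) R)
  have hlim := tendsto_stratIntegral_of_tendsto hβ hαβ hγβ₁ hγβ₂ hF₂ hF₁ hd hgd hG
    (tendsto_lineAverage hgc v) S
  -- For fixed `k` the germ has order 2 + min(β₁, β₂) > 2 on the line, and subdivision never leaves
  -- the line.
  have hzero (k) : stratIntegral F (G k) S = 0 := by
    have hGc := HolderBall.continuous hβ₁' hβ₂' (hG k)
    obtain ⟨T, hT⟩ : ∃ T, ∀ i, r i ∈ Set.Icc (-T) T :=
      ⟨‖r‖, fun i => abs_le.1 (norm_le_pi_norm r i)⟩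
    obtain ⟨K₀, hK₀⟩ := (isCompact_lineSegment p v T).exists_bound_of_continuousOn
      (continuous_comp hα hF₂ hF₁ hGc).continuousOn
    obtain ⟨K₁, hK₁⟩ := exists_c1Bound_lineAverage hβ₁'.le hβ₂'.le hc hg hgc hv (hδ0 k) p T 0
    obtain ⟨K₂, hK₂⟩ := exists_c1Bound_lineAverage hβ₁'.le hβ₂'.le hc hg hgc hv (hδ0 k) p T 1
    set K := max (max K₀ 0) (max K₁ K₂)
    have hbound := germBound_strat_lineSegment (f := fun x => F x (G k x))
      (g1 := fun x => G k x 0) (g2 := fun x => G k x 1) hv (lt_min hβ₁' hβ₂').le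
      ((le_max_right K₀ 0).trans (le_max_left _ (max K₁ K₂)))
      (fun x hx => (hK₀ x hx).trans ((le_max_left K₀ 0).trans (le_max_left _ (max K₁ K₂))))
      (hK₁ K ((le_max_left _ _).trans (le_max_right _ _)))
      (hK₂ K ((le_max_right _ _).trans (le_max_right _ _)))
    refine tendsto_nhds_unique
      (tendsto_stratIntegral hβ hαβ hγβ₁ hγβ₂ hF₂ hF₁ hd (hG k) S)
      (tendsto_stratSum_zero_of_germBound (convex_lineSegment p v T) ?_ hbound
        fun i => ⟨r i, hT i, (hr i).symm⟩)
    linarith [lt_min hβ₁' hβ₂']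
  simp only [hzero] at hlim
  exact (tendsto_nhds_unique hlim tendsto_const_nhds)

end Nonatomic

/-! ### From the Hölder hypotheses to uniform constants -/

lemma exists_holderBall {β₁ β₂ : ℝ≥0} {g : Plane → Plane} (h1 : IsHolder β₁ fun x => g x 0)
    (h2 : IsHolder β₂ fun x => g x 1) :
    ∃ c : ℝ → ℝ, (∀ R, 0 ≤ c R) ∧ ∀ R, HolderBall R (c R) β₁ β₂ g := by
  choose c₁ hc₁ h₁ using fun R => exists_holder_of_holderNormOn_lt_top (h1 R)
  choose c₂ hc₂ h₂ using fun R => exists_holder_of_holderNormOn_lt_top (h2 R)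
  refine ⟨fun R => max (c₁ R) (c₂ R), fun R => le_max_of_le_left (hc₁ R), fun R => ⟨fun p hp => ?_,
    fun p hp => ?_, fun p hp q hq => ?_, fun p hp q hq => ?_⟩⟩
  · exact (h₁ R p hp).1.trans (le_max_left _ _)
  · exact (h₂ R p hp).1.trans (le_max_right _ _)
  · refine ((h₁ R p hp).2 q hq).trans ?_
    gcongr
    exact le_max_left _ _
  · refine ((h₂ R p hp).2 q hq).trans ?_
    gcongr
    exact le_max_right _ _

/-- A pointwise convergent sequence with bounded Hölder seminorms is bounded in Hölder norm,
together with its limit. -/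
lemma exists_holderBall_of_tendsto {β₁ β₂ : ℝ≥0} {g : Plane → Plane} {G : ℕ → Plane → Plane}
    (hlim : ∀ x, Tendsto (fun k => G k x) atTop (𝓝 (g x)))
    (hG : ∀ R : ℝ, ∃ C : ℝ≥0, ∀ k : ℕ, HolderOnWith C β₁ (fun x => G k x 0) (closedBall 0 R) ∧
      HolderOnWith C β₂ (fun x => G k x 1) (closedBall 0 R)) :
    ∃ c : ℝ → ℝ, (∀ R, 0 ≤ c R) ∧ (∀ R, HolderBall R (c R) β₁ β₂ g) ∧
      ∀ k R, HolderBall R (c R) β₁ β₂ (G k) := by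
  choose C hC using hG
  -- Convergence at the origin bounds all the values there; the seminorms then bound the functions
  -- on each ball.
  obtain ⟨M, hM⟩ := (Metric.isBounded_range_of_tendsto _ (hlim 0)).exists_norm_le
  have hM0 (k) (i : Fin 2) : |G k 0 i| ≤ M :=
    (PiLp.norm_apply_le (G k 0) i).trans (hM _ ⟨k, rfl⟩)
  have hMnn : 0 ≤ M := (abs_nonneg _).trans (hM0 0 0)
  set P := fun R : ℝ => max (|R| ^ (β₁ : ℝ)) (|R| ^ (β₂ : ℝ))
  have hP (R) : 0 ≤ P R := le_max_of_le_left (by positivity)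
  have hbound {β : ℝ≥0} {h : Plane → ℝ} {R : ℝ} (hβ : |R| ^ (β : ℝ) ≤ P R)
      (hh : HolderOnWith (C R) β h (closedBall 0 R)) (h0 : |h 0| ≤ M) (p : Plane)
      (hp : p ∈ closedBall (0 : Plane) R) : |h p| ≤ C R + M + C R * P R := by
    have hR : 0 ≤ R := dist_nonneg.trans hp
    have e1 : |h p - h 0| ≤ C R * dist p 0 ^ (β : ℝ) :=
      hh.dist_le hp (mem_closedBall_self hR)
    have e2 : C R * dist p 0 ^ (β : ℝ) ≤ C R * P R := by
      refine mul_le_mul_of_nonneg_left (le_trans ?_ hβ) (C R).coe_nonneg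
      have : dist p 0 ≤ |R| := le_trans hp (le_abs_self R)
      gcongr
    have e3 := abs_add_le (h p - h 0) (h 0)
    rw [sub_add_cancel] at e3
    linarith [(C R).coe_nonneg]
  have hCle (R) : (C R : ℝ) ≤ C R + M + C R * P R := by
    have := mul_nonneg (C R).coe_nonneg (hP R)
    linarith
  have hball (k R) : HolderBall R (C R + M + C R * P R) β₁ β₂ (G k) := by
    refine ⟨hbound (le_max_left _ _) (hC R k).1 (hM0 k 0),
      hbound (le_max_right _ _) (hC R k).2 (hM0 k 1), fun p hp q hq => ?_, fun p hp q hq => ?_⟩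
    · refine ((hC R k).1.dist_le hp hq).trans ?_
      have := hCle R
      gcongr
    · refine ((hC R k).2.dist_le hp hq).trans ?_
      have := hCle R
      gcongr
  have hcoord (i : Fin 2) (x) : Tendsto (fun k => G k x i) atTop (𝓝 (g x i)) :=
    ((by fun_prop : Continuous fun u : Plane => u i).tendsto _).comp (hlim x)
  refine ⟨_, fun R => ((C R).coe_nonneg.trans (hCle R)), fun R => ⟨fun p hp => ?_, fun p hp => ?_,
    fun p hp q hq => ?_, fun p hp q hq => ?_⟩, hball⟩
  -- These inequalities are closed under pointwise convergence, so the limit inherits the same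
  -- constants.
  · exact le_of_tendsto' (hcoord 0 p).abs fun k => (hball k R).bound_fst p hp
  · exact le_of_tendsto' (hcoord 1 p).abs fun k => (hball k R).bound_snd p hp
  · exact le_of_tendsto' ((hcoord 0 p).sub (hcoord 0 q)).abs
      fun k => (hball k R).holder_fst p hp q hq
  · exact le_of_tendsto' ((hcoord 1 p).sub (hcoord 1 q)).abs
      fun k => (hball k R).holder_snd p hp q hq

end RoughForm

open RoughForm in
theorem theorem7p1 (α β₁ β₂ γ : ℝ≥0)
    (hα : 0 < α ∧ α ≤ 1) (hβ₁ : 0 < β₁ ∧ β₁ ≤ 1) (hβ₂ : 0 < β₂ ∧ β₂ ≤ 1) (hγ : 0 < γ ∧ γ ≤ 1)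
    (hβ : 1 < β₁ + β₂)
    (hαβ : 2 < α + β₁ + β₂)
    (hγβ₁ : 2 < (1 + γ) * β₁ + β₁ + β₂)
    (hγβ₂ : 2 < (1 + γ) * β₂ + β₁ + β₂)
    (F : Plane → Plane → ℝ)
    (hF₂ : ContinuousToC1Holder γ (fun u => F u))
    (hF₁ : ContinuousToHolder α (fun u x => F x u)) :
    (∀ g : Plane → Plane, IsHolder β₁ (fun x => g x 0) → IsHolder β₂ (fun x => g x 1) →
      (∀ S : Simp2,
        Tendsto (fun n : ℕ =>
            stratSum (fun x => F x (g x)) (fun x => g x 0) (fun x => g x 1) n S)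
          atTop (𝓝 (stratIntegral F g S))) ∧
      Continuous (stratIntegral F g) ∧
      Alternating (stratIntegral F g) ∧
      Nonatomic (stratIntegral F g)) ∧
    (∀ (g : Plane → Plane) (G : ℕ → Plane → Plane),
      (∀ x, Tendsto (fun k => G k x) atTop (𝓝 (g x))) →
      (∀ R : ℝ, ∃ C : ℝ≥0, ∀ k : ℕ,
        HolderOnWith C β₁ (fun x => G k x 0) (closedBall 0 R) ∧
        HolderOnWith C β₂ (fun x => G k x 1) (closedBall 0 R)) →
      ∀ S : Simp2,
        Tendsto (fun k => stratIntegral F (G k) S) atTop (𝓝 (stratIntegral F g S))) := by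

  refine ⟨fun g h1 h2 => ?_, fun g G hlim hG S => ?_⟩
  · obtain ⟨c, hc, hg⟩ := exists_holderBall h1 h2
    exact ⟨tendsto_stratIntegral hβ hαβ hγβ₁ hγβ₂ hF₂ hF₁ hc hg,
      continuous_stratIntegral hα.1 hβ₁.1 hβ₂.1 hβ hαβ hγβ₁ hγβ₂ hF₂ hF₁ hc hg,
      alternating_stratIntegral hβ hαβ hγβ₁ hγβ₂ hF₂ hF₁ hc hg,
      nonatomic_stratIntegral hα.1 hβ₁.1 hβ₂.1 hβ hαβ hγβ₁ hγβ₂ hF₂ hF₁ hc hg⟩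
  · obtain ⟨c, hc, hg, hGc⟩ := exists_holderBall_of_tendsto hlim hG
    exact tendsto_stratIntegral_of_tendsto hβ hαβ hγβ₁ hγβ₂ hF₂ hF₁ hc hg hGc hlim S
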